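/- Let $\mathsf{RCA}^*_0$ be the subsystem of second-order arithmetic with the basic axioms of $\mathbb{N}$, the defining equations of exponentiation, $\Delta^0_0$ induction and $\Delta^0_1$ comprehension (both schemes with arbitrary number and set parameters; exponentiation is available as a function symbol). A structure $\langle M,\mathcal X\rangle$ for this language consists of a number domain $M$ with its arithmetical operations and order and a family $\mathcal X$ of subsets of $M$, over which the set quantifiers range. A statement is provable in $\mathsf{RCA}^*_0$ if and only if it holds in every model $\langle M,\mathcal X\rangle$ of $\mathsf{RCA}^*_0$. Inside such a model, consider structures $\mathbb A=\langle A,f,c\rangle$ with $A\in\mathcal X$, $c\in A$ and $f:A\to A$ a function whose graph, as a set of coded pairs, belongs to $\mathcal X$. Satisfaction $\mathbb A\models\xi$ of a second-order sentence $\xi$ in the language $\{f,c\}$ is understood inside the model: individual quantifiers range over $A$, and a quantifier over $k$-ary relations ranges over all $k$-ary relations on $A$ that belong to $\mathcal X$ (as sets of coded $k$-tuples). $\mathbb A$ is a *Peano system* if $f$ is one-to-one, $c\notin\mathrm{rng}(f)$, and every $X\in\mathcal X$ with $X\subseteq A$ that contains $c$ and is closed under $f$ equals $A$. For $x\in M$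 and $a\in A$, $f^x(c)=a$ means that there is in the model a finite sequence $\langle a_0,\dots,a_x\rangle$ of elements of $A$ with $a_0=c$, $a_{z+1}=f(a_z)$ for all $z<x$, and $a_x=a$; here a set of the model is finite if it is bounded in $M$. A Peano system is *almost isomorphic to $\langle\mathbb N,S,0\rangle$* if for every $a\in A$ there is some $x\in M$ with $f^x(c)=a$. A second-order formula is $\Sigma^1_1$ (respectively $\Pi^1_1$) if it consists of a block of existential (respectively universal) relation quantifiers, of arbitrary arities, followed by a formula without second-order quantifiers; a $\Sigma^1_1\wedge\Pi^1_1$ sentence is the conjunction of a $\Sigma^1_1$ sentence and a $\Pi^1_1$ sentence. **Lemma.** There exists a $\Sigma^1_1\wedge\Pi^1_1$ sentence $\xi$ in the language with one unary function symbol $f$ and one individual constant $c$ such that $\mathsf{RCA}^*_0$ proves: for every structure $\mathbb A=\langle A,f,c\rangle$, $\mathbb A\models\xi$ if and only if $\mathbb A$ is a Peano system almost isomorphic to $\langle\mathbb N,S,0\rangle$. -/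

import Mathlib

universe u

/-! ## Second-order arithmetic and the theory `RCA*_0` -/

/-- A (Henkin) structure for the language of second-order arithmetic with exponentiation: a number
domain `carrier` with the arithmetical operations and the order, and a family `sets` of subsets of
it, over which the set variables range. -/
structure ArithStructure where
  carrier : Type u
  zero : carrier
  one : carrier
  add : carrier → carrier → carrier
  mul : carrier → carrier → carrier
  exp : carrier → carrier → carrier
  lt : carrier → carrier → Prop
  sets : Set (Set carrier)

/-- Numerical terms, with number variables indexed by `Fin n`. -/
inductive NumTerm (n : ℕ) : Type
  | var (i : Fin n) : NumTerm n
  | zero : NumTerm n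
  | one : NumTerm n
  | add (s t : NumTerm n) : NumTerm n
  | mul (s t : NumTerm n) : NumTerm n
  | exp (s t : NumTerm n) : NumTerm n

/-- Bounded (`Δ^0_0`) formulas, with free set variables indexed by `Fin k` and free number
variables indexed by `Fin n`. In `ball t φ` and `bex t φ`, the variable `0` of `φ` is the bound
one, and the bound `t` does not contain it. -/
inductive BddFormula (k : ℕ) : ℕ → Type
  | eq {n : ℕ} (s t : NumTerm n) : BddFormula k n
  | lt {n : ℕ} (s t : NumTerm n) : BddFormula k n
  | mem {n : ℕ} (t : NumTerm n) (i : Fin k) : BddFormula k n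
  | not {n : ℕ} (φ : BddFormula k n) : BddFormula k n
  | and {n : ℕ} (φ ψ : BddFormula k n) : BddFormula k n
  | or {n : ℕ} (φ ψ : BddFormula k n) : BddFormula k n
  | ball {n : ℕ} (t : NumTerm n) (φ : BddFormula k (n + 1)) : BddFormula k n
  | bex {n : ℕ} (t : NumTerm n) (φ : BddFormula k (n + 1)) : BddFormula k n

/-- `Σ^0_1` formulas: a block of existential number quantifiers before a bounded formula. -/
inductive SigmaFormula (k : ℕ) : ℕ → Type
  | bdd {n : ℕ} (φ : BddFormula k n) : SigmaFormula k n
  | ex {n : ℕ} (φ : SigmaFormula k (n + 1)) : SigmaFormula k n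

/-- `Π^0_1` formulas: a block of universal number quantifiers before a bounded formula. -/
inductive PiFormula (k : ℕ) : ℕ → Type
  | bdd {n : ℕ} (φ : BddFormula k n) : PiFormula k n
  | all {n : ℕ} (φ : PiFormula k (n + 1)) : PiFormula k n

namespace NumTerm

/-- The value of a term. -/
def val (𝓜 : ArithStructure.{u}) {n : ℕ} (v : Fin n → 𝓜.carrier) : NumTerm n → 𝓜.carrier
  | var i => v i
  | zero => 𝓜.zero
  | one => 𝓜.one
  | add s t => 𝓜.add (s.val 𝓜 v) (t.val 𝓜 v)
  | mul s t => 𝓜.mul (s.val 𝓜 v) (t.val 𝓜 v)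
  | exp s t => 𝓜.exp (s.val 𝓜 v) (t.val 𝓜 v)

end NumTerm

/-- Truth of a bounded formula under an assignment `V` of the set variables and `v` of the number
variables. -/
def BddFormula.Sat (𝓜 : ArithStructure.{u}) {k : ℕ} (V : Fin k → Set 𝓜.carrier) :
    {n : ℕ} → BddFormula k n → (Fin n → 𝓜.carrier) → Prop
  | _, .eq s t, v => s.val 𝓜 v = t.val 𝓜 v
  | _, .lt s t, v => 𝓜.lt (s.val 𝓜 v) (t.val 𝓜 v)
  | _, .mem t i, v => t.val 𝓜 v ∈ V i
  | _, .not φ, v => ¬ φ.Sat 𝓜 V v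
  | _, .and φ ψ, v => φ.Sat 𝓜 V v ∧ ψ.Sat 𝓜 V v
  | _, .or φ ψ, v => φ.Sat 𝓜 V v ∨ ψ.Sat 𝓜 V v
  | _, .ball t φ, v =>
      ∀ y : 𝓜.carrier, 𝓜.lt y (t.val 𝓜 v) → φ.Sat 𝓜 V (Fin.cons y v : Fin (_ + 1) → 𝓜.carrier)
  | _, .bex t φ, v =>
      ∃ y : 𝓜.carrier, 𝓜.lt y (t.val 𝓜 v) ∧ φ.Sat 𝓜 V (Fin.cons y v : Fin (_ + 1) → 𝓜.carrier)

/-- Truth of a `Σ^0_1` formula. -/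
def SigmaFormula.Sat (𝓜 : ArithStructure.{u}) {k : ℕ} (V : Fin k → Set 𝓜.carrier) :
    {n : ℕ} → SigmaFormula k n → (Fin n → 𝓜.carrier) → Prop
  | _, .bdd φ, v => φ.Sat 𝓜 V v
  | _, .ex φ, v => ∃ y : 𝓜.carrier, φ.Sat 𝓜 V (Fin.cons y v : Fin (_ + 1) → 𝓜.carrier)

/-- Truth of a `Π^0_1` formula. -/
def PiFormula.Sat (𝓜 : ArithStructure.{u}) {k : ℕ} (V : Fin k → Set 𝓜.carrier) :
    {n : ℕ} → PiFormula k n → (Fin n → 𝓜.carrier) → Prop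
  | _, .bdd φ, v => φ.Sat 𝓜 V v
  | _, .all φ, v => ∀ y : 𝓜.carrier, φ.Sat 𝓜 V (Fin.cons y v : Fin (_ + 1) → 𝓜.carrier)

namespace ArithStructure

/-- `𝓜` is a model of `RCA*_0` (as axiomatized by Simpson and Smith, in the language with a symbol
for exponentiation): basic axioms, recursion equations of exponentiation, `Δ^0_0` induction and
`Δ^0_1` comprehension, the two schemes with arbitrary number and set parameters. -/
structure IsModelRCAStar (𝓜 : ArithStructure.{u}) : Prop where
  succ_ne_zero : ∀ m, 𝓜.add m 𝓜.one ≠ 𝓜.zero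
  succ_inj : ∀ m n, 𝓜.add m 𝓜.one = 𝓜.add n 𝓜.one → m = n
  add_zero : ∀ m, 𝓜.add m 𝓜.zero = m
  add_succ : ∀ m n, 𝓜.add m (𝓜.add n 𝓜.one) = 𝓜.add (𝓜.add m n) 𝓜.one
  mul_zero : ∀ m, 𝓜.mul m 𝓜.zero = 𝓜.zero
  mul_succ : ∀ m n, 𝓜.mul m (𝓜.add n 𝓜.one) = 𝓜.add (𝓜.mul m n) m
  not_lt_zero : ∀ m, ¬ 𝓜.lt m 𝓜.zero
  lt_succ : ∀ m n, 𝓜.lt m (𝓜.add n 𝓜.one) ↔ 𝓜.lt m n ∨ m = n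
  exp_zero : ∀ m, 𝓜.exp m 𝓜.zero = 𝓜.one
  exp_succ : ∀ m n, 𝓜.exp m (𝓜.add n 𝓜.one) = 𝓜.mul (𝓜.exp m n) m
  bdd_induction : ∀ (k n : ℕ) (φ : BddFormula k (n + 1)) (V : Fin k → Set 𝓜.carrier)
    (v : Fin n → 𝓜.carrier), (∀ i, V i ∈ 𝓜.sets) →
    φ.Sat 𝓜 V (Fin.cons 𝓜.zero v : Fin (n + 1) → 𝓜.carrier) →
    (∀ x, φ.Sat 𝓜 V (Fin.cons x v : Fin (n + 1) → 𝓜.carrier) →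
      φ.Sat 𝓜 V (Fin.cons (𝓜.add x 𝓜.one) v : Fin (n + 1) → 𝓜.carrier)) →
    ∀ x, φ.Sat 𝓜 V (Fin.cons x v : Fin (n + 1) → 𝓜.carrier)
  delta_comprehension : ∀ (k n : ℕ) (φ : SigmaFormula k (n + 1)) (ψ : PiFormula k (n + 1))
    (V : Fin k → Set 𝓜.carrier) (v : Fin n → 𝓜.carrier), (∀ i, V i ∈ 𝓜.sets) →
    (∀ x, φ.Sat 𝓜 V (Fin.cons x v : Fin (n + 1) → 𝓜.carrier) ↔
      ψ.Sat 𝓜 V (Fin.cons x v : Fin (n + 1) → 𝓜.carrier)) →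
    {x | φ.Sat 𝓜 V (Fin.cons x v : Fin (n + 1) → 𝓜.carrier)} ∈ 𝓜.sets

/-- The code `(m + n)² + m` of the pair `⟨m, n⟩`. -/
def pair (𝓜 : ArithStructure.{u}) (m n : 𝓜.carrier) : 𝓜.carrier :=
  𝓜.add (𝓜.mul (𝓜.add m n) (𝓜.add m n)) m

/-- The code of a tuple: `⟨a⟩ = a` and `⟨a₁, …, aₖ, b⟩ = ⟨⟨a₁, …, aₖ⟩, b⟩` (and `0` for the empty
tuple). -/
def tuple (𝓜 : ArithStructure.{u}) : (k : ℕ) → (Fin k → 𝓜.carrier) → 𝓜.carrier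
  | 0, _ => 𝓜.zero
  | 1, a => a 0
  | k + 2, a => 𝓜.pair (tuple 𝓜 (k + 1) (fun i => a i.castSucc)) (a (Fin.last (k + 1)))

/-- `S` is `𝓜`-finite: it is a set of `𝓜` that is bounded in `𝓜`. -/
def IsFiniteSet (𝓜 : ArithStructure.{u}) (S : Set 𝓜.carrier) : Prop :=
  S ∈ 𝓜.sets ∧ ∃ b, ∀ m ∈ S, 𝓜.lt m b

/-- A structure `⟨A, f, c⟩` (one unary function and one constant) inside `𝓜`: the universe `A` and
the graph of `f`, as a set of coded pairs, are sets of `𝓜`. -/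
structure InternalStructure (𝓜 : ArithStructure.{u}) where
  A : Set 𝓜.carrier
  A_mem : A ∈ 𝓜.sets
  f : A → A
  graph_mem : {m | ∃ a : A, m = 𝓜.pair a (f a)} ∈ 𝓜.sets
  c : A

end ArithStructure

/-! ## Second-order logic over the language `{f, c}` -/

/-- Terms in the language with one unary function `f` and one constant `c`. -/
inductive PTerm (n : ℕ) : Type
  | var (i : Fin n) : PTerm n
  | c : PTerm n
  | f (t : PTerm n) : PTerm n

/-- Second-order formulas in the language `{f, c}`. The list `Γ` holds the arities of the free
relation variables; the free individual variables are indexed by `Fin n`. A quantifier binds the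
variable `0` (the head of the list) of the formula below it. -/
inductive SOFormula : List ℕ → ℕ → Type
  | eq {Γ : List ℕ} {n : ℕ} (s t : PTerm n) : SOFormula Γ n
  | rel {Γ : List ℕ} {n : ℕ} (R : Fin Γ.length) (ts : Fin (Γ.get R) → PTerm n) : SOFormula Γ n
  | not {Γ : List ℕ} {n : ℕ} (φ : SOFormula Γ n) : SOFormula Γ n
  | and {Γ : List ℕ} {n : ℕ} (φ ψ : SOFormula Γ n) : SOFormula Γ n
  | or {Γ : List ℕ} {n : ℕ} (φ ψ : SOFormula Γ n) : SOFormula Γ n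
  | imp {Γ : List ℕ} {n : ℕ} (φ ψ : SOFormula Γ n) : SOFormula Γ n
  | all {Γ : List ℕ} {n : ℕ} (φ : SOFormula Γ (n + 1)) : SOFormula Γ n
  | ex {Γ : List ℕ} {n : ℕ} (φ : SOFormula Γ (n + 1)) : SOFormula Γ n
  | allRel {Γ : List ℕ} {n : ℕ} (k : ℕ) (φ : SOFormula (k :: Γ) n) : SOFormula Γ n
  | exRel {Γ : List ℕ} {n : ℕ} (k : ℕ) (φ : SOFormula (k :: Γ) n) : SOFormula Γ n

/-- Second-order sentences: no free variables of either kind. -/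
abbrev SOSentence : Type := SOFormula [] 0

namespace SOFormula

/-- No second-order quantifiers (free relation variables are allowed). -/
def IsFirstOrder : {Γ : List ℕ} → {n : ℕ} → SOFormula Γ n → Prop
  | _, _, .eq _ _ => True
  | _, _, .rel _ _ => True
  | _, _, .not φ => φ.IsFirstOrder
  | _, _, .and φ ψ => φ.IsFirstOrder ∧ ψ.IsFirstOrder
  | _, _, .or φ ψ => φ.IsFirstOrder ∧ ψ.IsFirstOrder
  | _, _, .imp φ ψ => φ.IsFirstOrder ∧ ψ.IsFirstOrder
  | _, _, .all φ => φ.IsFirstOrder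
  | _, _, .ex φ => φ.IsFirstOrder
  | _, _, .allRel _ _ => False
  | _, _, .exRel _ _ => False

/-- `Σ^1_1`: a block of existential relation quantifiers before a first-order formula. -/
inductive IsSigma11 : {Γ : List ℕ} → {n : ℕ} → SOFormula Γ n → Prop
  | firstOrder {Γ : List ℕ} {n : ℕ} {φ : SOFormula Γ n} (h : φ.IsFirstOrder) : IsSigma11 φ
  | exRel {Γ : List ℕ} {n k : ℕ} {φ : SOFormula (k :: Γ) n} (h : IsSigma11 φ) :
      IsSigma11 (SOFormula.exRel k φ)

/-- `Π^1_1`: a block of universal relation quantifiers before a first-order formula. -/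
inductive IsPi11 : {Γ : List ℕ} → {n : ℕ} → SOFormula Γ n → Prop
  | firstOrder {Γ : List ℕ} {n : ℕ} {φ : SOFormula Γ n} (h : φ.IsFirstOrder) : IsPi11 φ
  | allRel {Γ : List ℕ} {n k : ℕ} {φ : SOFormula (k :: Γ) n} (h : IsPi11 φ) :
      IsPi11 (SOFormula.allRel k φ)

/-- `Σ^1_1 ∧ Π^1_1`: the conjunction of a `Σ^1_1` and a `Π^1_1` formula. -/
def IsSigma11AndPi11 {Γ : List ℕ} {n : ℕ} (ξ : SOFormula Γ n) : Prop :=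
  ∃ σ π : SOFormula Γ n, σ.IsSigma11 ∧ π.IsPi11 ∧ ξ = σ.and π

end SOFormula

namespace ArithStructure.InternalStructure

variable {𝓜 : ArithStructure.{u}} (𝔸 : 𝓜.InternalStructure)

/-- The `k`-ary relation `R` on `A` exists in `𝓜`: the set of codes of its tuples is a set of
`𝓜`. -/
def IsInternalRel {k : ℕ} (R : (Fin k → 𝔸.A) → Prop) : Prop :=
  {m | ∃ a : Fin k → 𝔸.A, R a ∧ m = 𝓜.tuple k (fun i => (a i : 𝓜.carrier))} ∈ 𝓜.sets

/-- The value of a term in `⟨A, f, c⟩`. -/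
def termVal {n : ℕ} (v : Fin n → 𝔸.A) : PTerm n → 𝔸.A
  | .var i => v i
  | .c => 𝔸.c
  | .f t => 𝔸.f (termVal v t)

/-- Satisfaction of a second-order formula in `⟨A, f, c⟩`, as understood inside `𝓜`: individual
quantifiers range over `A`, and `k`-ary relation quantifiers over all `k`-ary relations on `A`
that exist in `𝓜`. -/
def Sat : {Γ : List ℕ} → {n : ℕ} → SOFormula Γ n →
    ((i : Fin Γ.length) → (Fin (Γ.get i) → 𝔸.A) → Prop) → (Fin n → 𝔸.A) → Prop
  | _, _, .eq s t, _, v => 𝔸.termVal v s = 𝔸.termVal v t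
  | _, _, .rel R ts, ρ, v => ρ R (fun i => 𝔸.termVal v (ts i))
  | _, _, .not φ, ρ, v => ¬ Sat φ ρ v
  | _, _, .and φ ψ, ρ, v => Sat φ ρ v ∧ Sat ψ ρ v
  | _, _, .or φ ψ, ρ, v => Sat φ ρ v ∨ Sat ψ ρ v
  | _, _, .imp φ ψ, ρ, v => Sat φ ρ v → Sat ψ ρ v
  | _, _, .all φ, ρ, v => ∀ a : 𝔸.A, Sat φ ρ (Fin.cons a v : Fin (_ + 1) → 𝔸.A)
  | _, _, .ex φ, ρ, v => ∃ a : 𝔸.A, Sat φ ρ (Fin.cons a v : Fin (_ + 1) → 𝔸.A)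
  | Γ, _, .allRel k φ, ρ, v => ∀ R : (Fin k → 𝔸.A) → Prop, 𝔸.IsInternalRel R →
      Sat φ (Fin.cons (α := fun i => (Fin ((k :: Γ).get i) → 𝔸.A) → Prop) R ρ) v
  | Γ, _, .exRel k φ, ρ, v => ∃ R : (Fin k → 𝔸.A) → Prop, 𝔸.IsInternalRel R ∧
      Sat φ (Fin.cons (α := fun i => (Fin ((k :: Γ).get i) → 𝔸.A) → Prop) R ρ) v

/-- `𝔸 ⊨ ξ`, inside `𝓜`, for a second-order sentence `ξ`. -/
def Models (ξ : SOSentence) : Prop :=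
  𝔸.Sat ξ (fun i => i.elim0) (fun i => i.elim0)

/-- `𝔸` is a Peano system in `𝓜`. -/
def IsPeanoSystem : Prop :=
  Function.Injective 𝔸.f ∧ (∀ a, 𝔸.f a ≠ 𝔸.c) ∧
    ∀ X ∈ 𝓜.sets, X ⊆ 𝔸.A → (𝔸.c : 𝓜.carrier) ∈ X →
      (∀ a : 𝔸.A, (a : 𝓜.carrier) ∈ X → (𝔸.f a : 𝓜.carrier) ∈ X) →
      ∀ a : 𝔸.A, (a : 𝓜.carrier) ∈ X

/-- `f^x(c) = a` in `𝓜`: there is a finite sequence `⟨a₀, …, aₓ⟩` of `𝓜` with `a₀ = c`,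
`a_{z+1} = f(a_z)` for `z < x`, and `aₓ = a`. A finite sequence is given by its `𝓜`-finite graph;
only the values of `s` at arguments `z ≤ x` matter. -/
def IsIterate (x : 𝓜.carrier) (a : 𝔸.A) : Prop :=
  ∃ s : 𝓜.carrier → 𝔸.A,
    𝓜.IsFiniteSet {m | ∃ z, (𝓜.lt z x ∨ z = x) ∧ m = 𝓜.pair z (s z)} ∧
    s 𝓜.zero = 𝔸.c ∧ (∀ z, 𝓜.lt z x → s (𝓜.add z 𝓜.one) = 𝔸.f (s z)) ∧ s x = a

/-- `𝔸` is almost isomorphic to `⟨ℕ, S, 0⟩` in `𝓜`: it is a Peano system in which every element is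
of the form `f^x(c)` for some number `x` of `𝓜`. -/
def IsAlmostIsoNat : Prop :=
  𝔸.IsPeanoSystem ∧ ∀ a : 𝔸.A, ∃ x : 𝓜.carrier, 𝔸.IsIterate x a

end ArithStructure.InternalStructure

/-! In a Peano system every element ought to be an iterate `f^x(c)` by induction, but "some sequence
leads from `c` to `b`" is `Σ^0_1`, and neither induction nor comprehension is available for it in
`RCA*_0`. The way out is to bound the sequence in advance, so that the property becomes `Δ^0_0` and
defines a set.

Suppose `r` is a set relation that behaves like "reached no later than" (`IsReach`), and that the
section `{b | r b a}` lies below some `N`. Iterates inside this section are distinct, so by the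
pigeonhole principle a sequence of them has length at most `N`, and its graph is coded by a number
below `2 ^ ⟨N, N⟩`. All quantifiers are now bounded, and Peano induction on "if `r b a`, then `b` is
an iterate with such a code" reaches `a` (`exists_isIterate`).

Boundedness in the number domain is not a notion of the language `{f, c}`. It is replaced by a
finiteness condition that can be expressed with universal relation quantifiers: every strict order
has a maximal element on the section. Applied to the order of the numbers, this yields a bound;
conversely, bounded induction finds a maximal element on each bounded section (`exists_maximal`).

The sentence thus says that some reach relation exists (`Σ^1_1`), and that Peano's axioms hold and
the sections of every reach relation are finite in this sense (`Π^1_1`). The two parts need not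
share a relation. For the converse, when all elements are iterates, comparison of indices is `Δ^0_1`
and gives a reach relation (`exists_isReach`), while any reach relation confines the section of
`f^x(c)` to the values of one finite sequence (`IsReach.exists_bound`). -/

/-! ### Renaming of variables -/

namespace NumTerm

/-- Renaming of the variables of a term. -/
def rename {n m : ℕ} (ρ : Fin n → Fin m) : NumTerm n → NumTerm m
  | var i => var (ρ i)
  | zero => zero
  | one => one
  | add s t => add (s.rename ρ) (t.rename ρ)
  | mul s t => mul (s.rename ρ) (t.rename ρ)
  | exp s t => exp (s.rename ρ) (t.rename ρ)

theorem val_rename (𝓜 : ArithStructure.{u}) {n m : ℕ} (ρ : Fin n → Fin m) (t : NumTerm n)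
    (v : Fin m → 𝓜.carrier) : (t.rename ρ).val 𝓜 v = t.val 𝓜 (fun i => v (ρ i)) := by
  induction t <;> simp_all [rename, val]

end NumTerm

namespace BddFormula

/-- The lifting of a renaming below a binder. -/
def liftVar {n m : ℕ} (ρ : Fin n → Fin m) : Fin (n + 1) → Fin (m + 1) :=
  Fin.cons 0 (fun i => (ρ i).succ)

/-- Renaming of the set variables and of the number variables of a bounded formula. -/
def rename {k l : ℕ} (θ : Fin k → Fin l) :
    {n m : ℕ} → (ρ : Fin n → Fin m) → BddFormula k n → BddFormula l m
  | _, _, ρ, eq s t => eq (s.rename ρ) (t.rename ρ)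
  | _, _, ρ, lt s t => lt (s.rename ρ) (t.rename ρ)
  | _, _, ρ, mem t i => mem (t.rename ρ) (θ i)
  | _, _, ρ, not φ => not (φ.rename θ ρ)
  | _, _, ρ, and φ ψ => and (φ.rename θ ρ) (ψ.rename θ ρ)
  | _, _, ρ, or φ ψ => or (φ.rename θ ρ) (ψ.rename θ ρ)
  | _, _, ρ, ball t φ => ball (t.rename ρ) (φ.rename θ (liftVar ρ))
  | _, _, ρ, bex t φ => bex (t.rename ρ) (φ.rename θ (liftVar ρ))

theorem cons_liftVar {α : Type*} {n m : ℕ} (ρ : Fin n → Fin m) (v : Fin m → α) (y : α) :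
    (fun i => (Fin.cons y v : Fin (m + 1) → α) (liftVar ρ i)) =
      (Fin.cons y (fun i => v (ρ i)) : Fin (n + 1) → α) := by
  funext i
  refine Fin.cases ?_ (fun j => ?_) i <;> simp [liftVar]

theorem sat_rename (𝓜 : ArithStructure.{u}) {k l : ℕ} (θ : Fin k → Fin l)
    (V : Fin l → Set 𝓜.carrier) {n : ℕ} (φ : BddFormula k n) :
    ∀ {m : ℕ} (ρ : Fin n → Fin m) (v : Fin m → 𝓜.carrier),
      (φ.rename θ ρ).Sat 𝓜 V v ↔ φ.Sat 𝓜 (fun i => V (θ i)) (fun i => v (ρ i)) := by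
  induction φ with
  | ball t φ ih => intro m ρ v; simp only [rename, Sat, ih, NumTerm.val_rename, cons_liftVar]
  | bex t φ ih => intro m ρ v; simp only [rename, Sat, ih, NumTerm.val_rename, cons_liftVar]
  | _ => intro m ρ v; simp_all [rename, Sat, NumTerm.val_rename]

end BddFormula

/-! ### Closure properties of bounded definability with parameters -/

namespace ArithStructure

variable {𝓜 : ArithStructure.{u}}

instance : Zero 𝓜.carrier := ⟨𝓜.zero⟩
instance : One 𝓜.carrier := ⟨𝓜.one⟩
instance : Add 𝓜.carrier := ⟨𝓜.add⟩
instance : Mul 𝓜.carrier := ⟨𝓜.mul⟩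
instance : LT 𝓜.carrier := ⟨𝓜.lt⟩

/-- The assignment in which each variable is either a coordinate of `v` or a parameter. -/
def paramEnv {n m : ℕ} (e : Fin m → Fin n ⊕ 𝓜.carrier) (v : Fin n → 𝓜.carrier) :
    Fin m → 𝓜.carrier :=
  fun i => Sum.elim v id (e i)

/-- Functions given by a term with parameters. -/
def IsTerm {n : ℕ} (t : (Fin n → 𝓜.carrier) → 𝓜.carrier) : Prop :=
  ∃ (m : ℕ) (τ : NumTerm m) (e : Fin m → Fin n ⊕ 𝓜.carrier), ∀ v, τ.val 𝓜 (paramEnv e v) = t v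

/-- Relations defined by a bounded formula with number and set parameters. -/
def IsDelta {n : ℕ} (P : (Fin n → 𝓜.carrier) → Prop) : Prop :=
  ∃ (k m : ℕ) (φ : BddFormula k m) (V : Fin k → Set 𝓜.carrier) (e : Fin m → Fin n ⊕ 𝓜.carrier),
    (∀ i, V i ∈ 𝓜.sets) ∧ ∀ v, φ.Sat 𝓜 V (paramEnv e v) ↔ P v

theorem paramEnv_append_left {n m m' : ℕ} (e : Fin m → Fin n ⊕ 𝓜.carrier)
    (e' : Fin m' → Fin n ⊕ 𝓜.carrier) (v : Fin n → 𝓜.carrier) :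
    (fun i => paramEnv (Fin.append e e') v (Fin.castAdd m' i)) = paramEnv e v := by
  funext i; simp [paramEnv]

theorem paramEnv_append_right {n m m' : ℕ} (e : Fin m → Fin n ⊕ 𝓜.carrier)
    (e' : Fin m' → Fin n ⊕ 𝓜.carrier) (v : Fin n → 𝓜.carrier) :
    (fun i => paramEnv (Fin.append e e') v (Fin.natAdd m i)) = paramEnv e' v := by
  funext i; simp [paramEnv]

namespace IsTerm

variable {n : ℕ} {s t : (Fin n → 𝓜.carrier) → 𝓜.carrier}

theorem var (i : Fin n) : IsTerm (𝓜 := 𝓜) (fun v => v i) :=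
  ⟨1, .var 0, fun _ => .inl i, fun _ => rfl⟩

theorem const (a : 𝓜.carrier) : IsTerm (fun _ : Fin n → 𝓜.carrier => a) :=
  ⟨1, .var 0, fun _ => .inr a, fun _ => rfl⟩

theorem common (hs : IsTerm s) (ht : IsTerm t) :
    ∃ (m : ℕ) (σ τ : NumTerm m) (e : Fin m → Fin n ⊕ 𝓜.carrier),
      (∀ v, σ.val 𝓜 (paramEnv e v) = s v) ∧ ∀ v, τ.val 𝓜 (paramEnv e v) = t v := by
  obtain ⟨m, σ, e, hσ⟩ := hs
  obtain ⟨m', τ, e', hτ⟩ := ht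
  refine ⟨m + m', σ.rename (Fin.castAdd m'), τ.rename (Fin.natAdd m), Fin.append e e', ?_, ?_⟩
  · intro v; rw [NumTerm.val_rename, paramEnv_append_left, hσ]
  · intro v; rw [NumTerm.val_rename, paramEnv_append_right, hτ]

theorem add (hs : IsTerm s) (ht : IsTerm t) : IsTerm (fun v => s v + t v) := by
  obtain ⟨m, σ, τ, e, hσ, hτ⟩ := common hs ht
  exact ⟨m, .add σ τ, e, fun v => by simp only [NumTerm.val, hσ, hτ]; rfl⟩

theorem mul (hs : IsTerm s) (ht : IsTerm t) : IsTerm (fun v => s v * t v) := by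
  obtain ⟨m, σ, τ, e, hσ, hτ⟩ := common hs ht
  exact ⟨m, .mul σ τ, e, fun v => by simp only [NumTerm.val, hσ, hτ]; rfl⟩

theorem exp (hs : IsTerm s) (ht : IsTerm t) : IsTerm (fun v => 𝓜.exp (s v) (t v)) := by
  obtain ⟨m, σ, τ, e, hσ, hτ⟩ := common hs ht
  exact ⟨m, .exp σ τ, e, fun v => by simp only [NumTerm.val, hσ, hτ]⟩

theorem lift (ht : IsTerm t) :
    IsTerm (fun v : Fin (n + 1) → 𝓜.carrier => t (fun i => v i.succ)) := by
  obtain ⟨m, τ, e, hτ⟩ := ht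
  refine ⟨m, τ, fun i => Sum.map Fin.succ id (e i), fun v => ?_⟩
  refine Eq.trans (congrArg (fun w => τ.val 𝓜 w) (funext fun i => ?_)) (hτ _)
  rcases h : e i with j | a <;> simp [paramEnv, h]

theorem pair (hs : IsTerm s) (ht : IsTerm t) : IsTerm (fun v => 𝓜.pair (s v) (t v)) :=
  ((hs.add ht).mul (hs.add ht)).add hs

end IsTerm

namespace IsDelta

variable {n : ℕ} {s t : (Fin n → 𝓜.carrier) → 𝓜.carrier} {P Q : (Fin n → 𝓜.carrier) → Prop}

theorem congr (hP : IsDelta P) (h : ∀ v, P v ↔ Q v) : IsDelta Q := by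
  rwa [show Q = P from funext fun v => propext (h v).symm]

theorem eq (hs : IsTerm s) (ht : IsTerm t) : IsDelta (fun v => s v = t v) := by
  obtain ⟨m, σ, τ, e, hσ, hτ⟩ := hs.common ht
  exact ⟨0, m, .eq σ τ, Fin.elim0, e, fun i => i.elim0,
    fun v => by simp only [BddFormula.Sat, hσ, hτ]⟩

theorem lt (hs : IsTerm s) (ht : IsTerm t) : IsDelta (fun v => s v < t v) := by
  obtain ⟨m, σ, τ, e, hσ, hτ⟩ := hs.common ht
  exact ⟨0, m, .lt σ τ, Fin.elim0, e, fun i => i.elim0,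
    fun v => by simp only [BddFormula.Sat, hσ, hτ]; rfl⟩

theorem mem {X : Set 𝓜.carrier} (hX : X ∈ 𝓜.sets) (ht : IsTerm t) : IsDelta (fun v => t v ∈ X) := by
  obtain ⟨m, τ, e, hτ⟩ := ht
  exact ⟨1, m, .mem τ 0, fun _ => X, e, fun _ => hX, fun v => by simp only [BddFormula.Sat, hτ]⟩

theorem not (hP : IsDelta P) : IsDelta (fun v => ¬ P v) := by
  obtain ⟨k, m, φ, V, e, hV, hφ⟩ := hP
  exact ⟨k, m, .not φ, V, e, hV, fun v => by simp only [BddFormula.Sat, hφ]⟩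

theorem common (hP : IsDelta P) (hQ : IsDelta Q) :
    ∃ (k m : ℕ) (φ ψ : BddFormula k m) (V : Fin k → Set 𝓜.carrier)
      (e : Fin m → Fin n ⊕ 𝓜.carrier), (∀ i, V i ∈ 𝓜.sets) ∧
      (∀ v, φ.Sat 𝓜 V (paramEnv e v) ↔ P v) ∧ ∀ v, ψ.Sat 𝓜 V (paramEnv e v) ↔ Q v := by
  obtain ⟨k, m, φ, V, e, hV, hφ⟩ := hP
  obtain ⟨k', m', ψ, V', e', hV', hψ⟩ := hQ
  refine ⟨k + k', m + m', φ.rename (Fin.castAdd k') (Fin.castAdd m'),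
    ψ.rename (Fin.natAdd k) (Fin.natAdd m), Fin.append V V', Fin.append e e', ?_, ?_, ?_⟩
  · intro i; refine Fin.addCases (fun j => ?_) (fun j => ?_) i <;> simp [hV, hV']
  · intro v; simp only [BddFormula.sat_rename, paramEnv_append_left, Fin.append_left, hφ]
  · intro v; simp only [BddFormula.sat_rename, paramEnv_append_right, Fin.append_right, hψ]

theorem and (hP : IsDelta P) (hQ : IsDelta Q) : IsDelta (fun v => P v ∧ Q v) := by
  obtain ⟨k, m, φ, ψ, V, e, hV, hφ, hψ⟩ := common hP hQ
  exact ⟨k, m, .and φ ψ, V, e, hV, fun v => by simp only [BddFormula.Sat, hφ, hψ]⟩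

theorem or (hP : IsDelta P) (hQ : IsDelta Q) : IsDelta (fun v => P v ∨ Q v) := by
  obtain ⟨k, m, φ, ψ, V, e, hV, hφ, hψ⟩ := common hP hQ
  exact ⟨k, m, .or φ ψ, V, e, hV, fun v => by simp only [BddFormula.Sat, hφ, hψ]⟩

theorem imp (hP : IsDelta P) (hQ : IsDelta Q) : IsDelta (fun v => P v → Q v) :=
  (hP.not.or hQ).congr fun _ => imp_iff_not_or.symm

/-- A relation with parameters, with its first argument in the position of a bound variable. -/
theorem separate {P : (Fin (n + 1) → 𝓜.carrier) → Prop} (hP : IsDelta P) :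
    ∃ (k m : ℕ) (φ : BddFormula k (m + 1)) (V : Fin k → Set 𝓜.carrier)
      (e : Fin m → Fin n ⊕ 𝓜.carrier), (∀ i, V i ∈ 𝓜.sets) ∧
      ∀ v y, φ.Sat 𝓜 V (Fin.cons y (paramEnv e v) : Fin (m + 1) → 𝓜.carrier) ↔
        P (Fin.cons y v : Fin (n + 1) → 𝓜.carrier) := by
  obtain ⟨k, m, φ, V, e, hV, hφ⟩ := hP
  -- Variables that stood for the bound argument all become variable `0`; the others become `i.succ`
  -- and keep their value. The slots left vacant receive the value `0`, which is never read.
  refine ⟨k, m, φ.rename id (fun i => Sum.elim (Fin.cases 0 fun _ => i.succ) (fun _ => i.succ) (e i)),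
    V, fun i => Sum.elim (Fin.cases (.inr 0) .inl) .inr (e i), hV, fun v y => ?_⟩
  rw [BddFormula.sat_rename, ← hφ]
  refine iff_of_eq (congrArg (φ.Sat 𝓜 V) (funext fun i => ?_))
  rcases h : e i with j | a
  · refine Fin.cases (fun h => ?_) (fun j h => ?_) j h <;> simp [paramEnv, h]
  · simp [paramEnv, h]

theorem separate_bound {P : (Fin (n + 1) → 𝓜.carrier) → Prop} (ht : IsTerm t) (hP : IsDelta P) :
    ∃ (k m : ℕ) (τ : NumTerm m) (φ : BddFormula k (m + 1)) (V : Fin k → Set 𝓜.carrier)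
      (e : Fin m → Fin n ⊕ 𝓜.carrier), (∀ i, V i ∈ 𝓜.sets) ∧
      (∀ v, τ.val 𝓜 (paramEnv e v) = t v) ∧
      ∀ v y, φ.Sat 𝓜 V (Fin.cons y (paramEnv e v) : Fin (m + 1) → 𝓜.carrier) ↔
        P (Fin.cons y v : Fin (n + 1) → 𝓜.carrier) := by
  obtain ⟨k, m, φ, V, e, hV, hφ⟩ := hP.separate
  obtain ⟨m', τ, e', hτ⟩ := ht
  refine ⟨k, m + m', τ.rename (Fin.natAdd m),
    φ.rename id (BddFormula.liftVar (Fin.castAdd m')), V, Fin.append e e', hV, ?_, ?_⟩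
  · intro v; rw [NumTerm.val_rename, paramEnv_append_right, hτ]
  · intro v y
    rw [BddFormula.sat_rename, BddFormula.cons_liftVar, paramEnv_append_left]
    exact hφ v y

theorem bex {P : (Fin n → 𝓜.carrier) → 𝓜.carrier → Prop} (ht : IsTerm t)
    (hP : IsDelta (fun w : Fin (n + 1) → 𝓜.carrier => P (fun i => w i.succ) (w 0))) :
    IsDelta (fun v => ∃ y, y < t v ∧ P v y) := by
  obtain ⟨k, m, τ, φ, V, e, hV, hτ, hφ⟩ := separate_bound ht hP
  exact ⟨k, m, .bex τ φ, V, e, hV, fun v => by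
    simp only [BddFormula.Sat, hτ, hφ, Fin.cons_succ, Fin.cons_zero]; rfl⟩

theorem ball {P : (Fin n → 𝓜.carrier) → 𝓜.carrier → Prop} (ht : IsTerm t)
    (hP : IsDelta (fun w : Fin (n + 1) → 𝓜.carrier => P (fun i => w i.succ) (w 0))) :
    IsDelta (fun v => ∀ y, y < t v → P v y) := by
  obtain ⟨k, m, τ, φ, V, e, hV, hτ, hφ⟩ := separate_bound ht hP
  exact ⟨k, m, .ball τ φ, V, e, hV, fun v => by
    simp only [BddFormula.Sat, hτ, hφ, Fin.cons_succ, Fin.cons_zero]; rfl⟩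

end IsDelta

/-! ### Induction and comprehension for definable relations -/

namespace IsModelRCAStar

theorem induction (h𝓜 : 𝓜.IsModelRCAStar) {P : 𝓜.carrier → Prop}
    (hP : IsDelta (fun v : Fin 1 → 𝓜.carrier => P (v 0))) (h0 : P 0)
    (hs : ∀ x, P x → P (x + 1)) (x : 𝓜.carrier) : P x := by
  obtain ⟨k, m, φ, V, e, hV, hφ⟩ := hP.separate
  have key := fun y => hφ Fin.elim0 y
  simp only [Fin.cons_zero] at key
  refine (key x).1 (h𝓜.bdd_induction k m φ V _ hV ((key _).2 h0) (fun y hy => ?_) x)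
  exact (key _).2 (hs y ((key y).1 hy))

/-- This is `Δ^0_1` comprehension with the `Π^0_1` form given as the negation of a `Σ^0_1` one; a
single witness suffices on each side because further witnesses can be bounded by it. -/
theorem comprehension_of_ex (h𝓜 : 𝓜.IsModelRCAStar) {P Q : 𝓜.carrier → 𝓜.carrier → Prop}
    (hP : IsDelta (fun v : Fin 2 → 𝓜.carrier => P (v 0) (v 1)))
    (hQ : IsDelta (fun v : Fin 2 → 𝓜.carrier => Q (v 0) (v 1)))
    (hPQ : ∀ x, (∃ y, P y x) ↔ ¬ ∃ y, Q y x) : {x | ∃ y, P y x} ∈ 𝓜.sets := by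
  obtain ⟨k, m, φ, ψ, V, e, hV, hφ, hψ⟩ := hP.common hQ
  have env : ∀ (y x : 𝓜.carrier),
      (fun i => (Fin.cons y (Fin.cons x (fun j => Sum.elim (fun _ => 0) id (e j)) :
          Fin (m + 1) → 𝓜.carrier) : Fin (m + 1 + 1) → 𝓜.carrier)
        (Sum.elim (Fin.cases 0 fun _ => 1) (fun _ => i.succ.succ) (e i))) =
      paramEnv e ![y, x] := by
    intro y x
    funext i
    rcases h : e i with j | a
    · fin_cases j <;> simp [paramEnv, h]
      rfl
    · simp [paramEnv, h]
  have := h𝓜.delta_comprehension k m (.ex (.bdd (φ.rename id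
      (fun i => Sum.elim (Fin.cases 0 fun _ => 1) (fun _ => i.succ.succ) (e i)))))
    (.all (.bdd (.not (ψ.rename id
      (fun i => Sum.elim (Fin.cases 0 fun _ => 1) (fun _ => i.succ.succ) (e i))))))
    V (fun j => Sum.elim (fun _ => 0) id (e j)) hV
  simp only [SigmaFormula.Sat, PiFormula.Sat, BddFormula.Sat, BddFormula.sat_rename, env, id,
    hφ, hψ, Matrix.cons_val_zero, Matrix.cons_val_one] at this
  exact this (fun x => by rw [hPQ, not_exists])

theorem comprehension (h𝓜 : 𝓜.IsModelRCAStar) {P : 𝓜.carrier → Prop}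
    (hP : IsDelta (fun v : Fin 1 → 𝓜.carrier => P (v 0))) : {x | P x} ∈ 𝓜.sets := by
  obtain ⟨k, m, φ, V, e, hV, hφ⟩ := hP.separate
  have key := fun y => hφ Fin.elim0 y
  simp only [Fin.cons_zero] at key
  have := h𝓜.delta_comprehension k m (.bdd φ) (.bdd φ) V (paramEnv e Fin.elim0) hV
    (fun _ => Iff.rfl)
  simpa only [SigmaFormula.Sat, key] using this

end IsModelRCAStar
end ArithStructure

/-! ### The numbers as an ordered semiring -/

namespace ArithStructure
variable {𝓜 : ArithStructure.{u}}

section Arithmetic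
variable [h𝓜 : Fact 𝓜.IsModelRCAStar]

namespace Basic

theorem ind {P : 𝓜.carrier → Prop}
    (hP : IsDelta (fun v : Fin 1 → 𝓜.carrier => P (v 0))) (h0 : P 0)
    (hs : ∀ x, P x → P (x + 1)) (x : 𝓜.carrier) : P x := h𝓜.out.induction hP h0 hs x

theorem add_zero (a : 𝓜.carrier) : a + 0 = a := h𝓜.out.add_zero a
theorem add_succ (a b : 𝓜.carrier) : a + (b + 1) = a + b + 1 := h𝓜.out.add_succ a b
theorem mul_zero (a : 𝓜.carrier) : a * 0 = 0 := h𝓜.out.mul_zero a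
theorem mul_succ (a b : 𝓜.carrier) : a * (b + 1) = a * b + a := h𝓜.out.mul_succ a b
theorem succ_ne_zero (a : 𝓜.carrier) : a + 1 ≠ 0 := h𝓜.out.succ_ne_zero a
theorem succ_inj {a b : 𝓜.carrier} (h : a + 1 = b + 1) : a = b := h𝓜.out.succ_inj a b h
theorem not_lt_zero (a : 𝓜.carrier) : ¬ a < 0 := h𝓜.out.not_lt_zero a
theorem lt_succ {a b : 𝓜.carrier} : a < b + 1 ↔ a < b ∨ a = b := h𝓜.out.lt_succ a b

theorem zero_add (a : 𝓜.carrier) : 0 + a = a := by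
  refine ind (P := fun a => 0 + a = a) ?_ (add_zero 0) (fun x hx => ?_) a
  · apply_rules [IsDelta.eq, IsTerm.add, IsTerm.const, IsTerm.var]
  · rw [add_succ, hx]

theorem succ_add (a b : 𝓜.carrier) : a + 1 + b = a + b + 1 := by
  refine ind (P := fun b => a + 1 + b = a + b + 1) ?_ ?_ (fun x hx => ?_) b
  · apply_rules [IsDelta.eq, IsTerm.add, IsTerm.const, IsTerm.var]
  · simp only [add_zero]
  · simp only [add_succ, hx]

theorem add_comm (a b : 𝓜.carrier) : a + b = b + a := by
  refine ind (P := fun b => a + b = b + a) ?_ ?_ (fun x hx => ?_) b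
  · apply_rules [IsDelta.eq, IsTerm.add, IsTerm.const, IsTerm.var]
  · simp only [add_zero, zero_add]
  · simp only [add_succ, succ_add, hx]

theorem add_assoc (a b c : 𝓜.carrier) : a + b + c = a + (b + c) := by
  refine ind (P := fun c => a + b + c = a + (b + c)) ?_ ?_ (fun x hx => ?_) c
  · apply_rules [IsDelta.eq, IsTerm.add, IsTerm.const, IsTerm.var]
  · simp only [add_zero]
  · simp only [add_succ, hx]

instance : AddCommMonoid 𝓜.carrier where
  add_assoc := add_assoc
  zero_add := zero_add
  add_zero := add_zero
  add_comm := add_comm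
  nsmul := nsmulRec

theorem zero_mul (a : 𝓜.carrier) : 0 * a = 0 := by
  refine ind (P := fun a => 0 * a = 0) ?_ (mul_zero 0) (fun x hx => ?_) a
  · apply_rules [IsDelta.eq, IsTerm.mul, IsTerm.const, IsTerm.var]
  · rw [mul_succ, hx, add_zero]

theorem succ_mul (a b : 𝓜.carrier) : (a + 1) * b = a * b + b := by
  refine ind (P := fun b => (a + 1) * b = a * b + b) ?_ ?_ (fun x hx => ?_) b
  · apply_rules [IsDelta.eq, IsTerm.mul, IsTerm.add, IsTerm.const, IsTerm.var]
  · simp only [mul_zero, add_zero]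
  · simp only [mul_succ, hx]; abel

theorem mul_comm (a b : 𝓜.carrier) : a * b = b * a := by
  refine ind (P := fun b => a * b = b * a) ?_ ?_ (fun x hx => ?_) b
  · apply_rules [IsDelta.eq, IsTerm.mul, IsTerm.const, IsTerm.var]
  · simp only [mul_zero, zero_mul]
  · simp only [mul_succ, succ_mul, hx]

theorem mul_add (a b c : 𝓜.carrier) : a * (b + c) = a * b + a * c := by
  refine ind (P := fun c => a * (b + c) = a * b + a * c) ?_ ?_ (fun x hx => ?_) c
  · apply_rules [IsDelta.eq, IsTerm.mul, IsTerm.add, IsTerm.const, IsTerm.var]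
  · simp only [mul_zero, add_zero]
  · rw [add_succ, mul_succ, hx, mul_succ, add_assoc]

theorem mul_assoc (a b c : 𝓜.carrier) : a * b * c = a * (b * c) := by
  refine ind (P := fun c => a * b * c = a * (b * c)) ?_ ?_ (fun x hx => ?_) c
  · apply_rules [IsDelta.eq, IsTerm.mul, IsTerm.const, IsTerm.var]
  · simp only [mul_zero]
  · rw [mul_succ, mul_succ, mul_add, hx]

theorem mul_one (a : 𝓜.carrier) : a * 1 = a := by
  rw [← zero_add 1, mul_succ, mul_zero, zero_add]

instance : CommSemiring 𝓜.carrier where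
  mul_assoc := mul_assoc
  one_mul a := by rw [mul_comm, mul_one]
  mul_one := mul_one
  mul_comm := mul_comm
  left_distrib := mul_add
  right_distrib a b c := by rw [mul_comm, mul_add, mul_comm a, mul_comm b]
  zero_mul := zero_mul
  mul_zero := mul_zero

theorem zero_le (a : 𝓜.carrier) : 0 < a ∨ 0 = a := by
  refine ind (P := fun a => 0 < a ∨ 0 = a) ?_ (.inr rfl) (fun x hx => .inl (lt_succ.2 hx)) a
  apply_rules [IsDelta.or, IsDelta.eq, IsDelta.lt, IsTerm.const, IsTerm.var]

theorem lt_trans {a b : 𝓜.carrier} (c : 𝓜.carrier) (h : a < b) : b < c → a < c := by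
  refine ind (P := fun c => b < c → a < c) ?_ (fun h => (not_lt_zero _ h).elim)
    (fun x hx hb => ?_) c
  · apply_rules [IsDelta.imp, IsDelta.lt, IsTerm.const, IsTerm.var]
  · rcases lt_succ.1 hb with h' | rfl
    · exact lt_succ.2 (.inl (hx h'))
    · exact lt_succ.2 (.inl h)

theorem lt_succ_self (a : 𝓜.carrier) : a < a + 1 := lt_succ.2 (.inr rfl)

theorem succ_ne_self (a : 𝓜.carrier) : a + 1 ≠ a := by
  refine ind (P := fun a => a + 1 ≠ a) ?_ (succ_ne_zero 0)
    (fun x hx h => hx (succ_inj h)) a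
  apply_rules [IsDelta.not, IsDelta.eq, IsTerm.add, IsTerm.const, IsTerm.var]

theorem lt_irrefl (a : 𝓜.carrier) : ¬ a < a := by
  refine ind (P := fun a => ¬ a < a) ?_ (not_lt_zero 0) (fun x hx h => ?_) a
  · apply_rules [IsDelta.not, IsDelta.lt, IsTerm.const, IsTerm.var]
  · rcases lt_succ.1 h with h | h
    · exact hx (lt_trans _ (lt_succ_self x) h)
    · exact succ_ne_self x h

theorem succ_lt_succ {a : 𝓜.carrier} (b : 𝓜.carrier) : a < b → a + 1 < b + 1 := by
  refine ind (P := fun b => a < b → a + 1 < b + 1) ?_ (fun h => (not_lt_zero _ h).elim)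
    (fun x hx h => ?_) b
  · apply_rules [IsDelta.imp, IsDelta.lt, IsTerm.add, IsTerm.const, IsTerm.var]
  · rcases lt_succ.1 h with h | rfl
    · exact lt_trans _ (hx h) (lt_succ_self _)
    · exact lt_succ_self _

theorem lt_trichotomy (a b : 𝓜.carrier) : a < b ∨ a = b ∨ b < a := by
  refine ind (P := fun b => a < b ∨ a = b ∨ b < a) ?_ ?_ (fun x hx => ?_) b
  · apply_rules [IsDelta.or, IsDelta.eq, IsDelta.lt, IsTerm.const, IsTerm.var]
  · rcases zero_le a with h | h
    · exact .inr (.inr h)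
    · exact .inr (.inl h.symm)
  · rcases hx with h | rfl | h
    · exact .inl (lt_succ.2 (.inl h))
    · exact .inl (lt_succ_self _)
    · rcases lt_succ.1 (succ_lt_succ _ h) with h | h
      · exact .inr (.inr h)
      · exact .inr (.inl h.symm)

noncomputable instance : LinearOrder 𝓜.carrier where
  le a b := a < b ∨ a = b
  lt a b := a < b
  le_refl a := .inr rfl
  le_trans a b c := by
    rintro (h | rfl) (h' | rfl)
    · exact .inl (lt_trans _ h h')
    · exact .inl h
    · exact .inl h'
    · exact .inr rfl
  le_antisymm a b := by
    rintro (h | rfl) (h' | h')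
    · exact (lt_irrefl _ (lt_trans _ h h')).elim
    all_goals simp_all
  le_total a b := by
    rcases lt_trichotomy a b with h | h | h <;> simp [h]
  lt_iff_le_not_ge a b := by
    refine ⟨fun h => ⟨.inl h, ?_⟩, ?_⟩
    · rintro (h' | rfl)
      · exact lt_irrefl _ (lt_trans _ h h')
      · exact lt_irrefl _ h
    · rintro ⟨h | rfl, h'⟩
      · exact h
      · exact (h' (.inr rfl)).elim
  toDecidableLE := Classical.decRel _

end Basic

open Basic

theorem lt_add_one_iff' {a b : 𝓜.carrier} : a < b + 1 ↔ a ≤ b := Basic.lt_succ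

theorem add_lt_add_right' {a b : 𝓜.carrier} (h : a < b) (c : 𝓜.carrier) : a + c < b + c := by
  refine ind (P := fun c => a + c < b + c) ?_ (by simpa) (fun x hx => ?_) c
  · apply_rules [IsDelta.lt, IsTerm.add, IsTerm.const, IsTerm.var]
  · rw [← _root_.add_assoc, ← _root_.add_assoc]; exact succ_lt_succ _ hx

instance : IsOrderedCancelAddMonoid 𝓜.carrier where
  add_le_add_left a b h c := by
    rcases h.lt_or_eq with h | rfl
    · exact (add_lt_add_right' h c).le
    · exact le_rfl
  le_of_add_le_add_left a b c h := by
    by_contra! h'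
    have := add_lt_add_right' h' a
    rw [_root_.add_comm, _root_.add_comm b] at this
    exact absurd h this.not_ge

/-- The difference is given an explicit bound so that the induction formula is bounded. -/
theorem exists_add_of_le' {a : 𝓜.carrier} (b : 𝓜.carrier) : a ≤ b → ∃ c, c < b + 1 ∧ b = a + c := by
  refine ind (P := fun b => a < b ∨ a = b → ∃ c, c < b + 1 ∧ b = a + c) ?_ ?_ (fun x hx h => ?_) b
  · apply_rules [IsDelta.imp, IsDelta.or, IsDelta.bex, IsDelta.lt, IsDelta.eq, IsTerm.add,
      IsTerm.const, IsTerm.var]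
  · rintro (h | rfl)
    · exact (not_lt_zero _ h).elim
    · exact ⟨0, lt_succ_self _, (Basic.add_zero _).symm⟩
  · rcases h with h | rfl
    · obtain ⟨c, hc, h⟩ := hx (lt_succ.1 h)
      exact ⟨c + 1, succ_lt_succ _ hc, by rw [← _root_.add_assoc, ← h]⟩
    · exact ⟨0, lt_of_le_of_lt (zero_le _) (lt_succ_self _), (Basic.add_zero _).symm⟩

instance : CanonicallyOrderedAdd 𝓜.carrier where
  exists_add_of_le {a b} h := by
    obtain ⟨c, -, hc⟩ := exists_add_of_le' b h
    exact ⟨c, hc⟩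
  le_add_self a b := by
    have := add_le_add_left (show (0 : 𝓜.carrier) ≤ b from zero_le b) a
    rwa [_root_.zero_add] at this
  le_self_add a b := by
    have := add_le_add_right (show (0 : 𝓜.carrier) ≤ b from zero_le b) a
    rwa [_root_.add_zero] at this

theorem exists_add_one_of_ne_zero {a : 𝓜.carrier} (h : a ≠ 0) : ∃ b, a = b + 1 := by
  have h1 : 0 + 1 ≤ a := by
    by_contra! h'
    exact h (le_antisymm (lt_add_one_iff'.1 h') (zero_le a))
  obtain ⟨c, hc⟩ := exists_add_of_le h1
  exact ⟨c, by rw [hc]; ring⟩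

theorem mul_lt_mul_of_pos' {a b c : 𝓜.carrier} (hc : 0 < c) (h : a < b) : c * a < c * b := by
  obtain ⟨d, rfl⟩ := exists_add_of_le h.le
  obtain ⟨e, rfl⟩ := exists_add_one_of_ne_zero (a := d) (by rintro rfl; simp at h)
  calc c * a < c * a + c := by simpa
    _ ≤ c * (a + (e + 1)) := by
      rw [show c * (a + (e + 1)) = c * a + c + c * e by ring]; exact le_self_add

instance : IsStrictOrderedRing 𝓜.carrier where
  zero_le_one := zero_le 1
  exists_pair_ne := ⟨0 + 1, 0, succ_ne_zero 0⟩
  mul_lt_mul_of_pos_left c hc a b h := mul_lt_mul_of_pos' hc h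
  mul_lt_mul_of_pos_right c hc a b h := by
    simp only [_root_.mul_comm _ c]
    exact mul_lt_mul_of_pos' hc h

noncomputable instance : SuccAddOrder 𝓜.carrier where
  succ a := a + 1
  le_succ a := le_self_add
  max_of_succ_le {a} h := (h.not_gt (lt_succ_self a)).elim
  succ_le_of_lt {a b} h := by
    by_contra! h'
    exact absurd h (lt_add_one_iff'.1 h').not_gt
  succ_eq_add_one _ := rfl


/-! ### The pairing function -/

/-- The number `s * s + m` with `m ≤ s` lies in the interval from `s²` up to, but excluding, `(s +
1)²`, and these intervals are disjoint for distinct `s`. -/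
theorem mul_self_add_inj {s s' m m' : 𝓜.carrier} (hm : m ≤ s) (hm' : m' ≤ s')
    (h : s * s + m = s' * s' + m') : s = s' ∧ m = m' := by
  have key : ∀ {s s' m m' : 𝓜.carrier}, m ≤ s → s < s' → s * s + m < s' * s' + m' := by
    intro s s' m m' hm hs
    calc s * s + m < (s + 1) * (s + 1) := by
          rw [show (s + 1) * (s + 1) = s * s + (s + (s + 1)) by ring]
          exact add_lt_add_right (lt_of_le_of_lt hm (lt_of_lt_of_le (lt_succ_self s) le_add_self)) _
      _ ≤ s' * s' := mul_le_mul' (Order.add_one_le_of_lt hs) (Order.add_one_le_of_lt hs)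
      _ ≤ s' * s' + m' := le_self_add
  rcases _root_.lt_trichotomy s s' with hs | rfl | hs
  · exact absurd h (key hm hs).ne
  · exact ⟨rfl, add_left_cancel h⟩
  · exact absurd h (key hm' hs).ne'

theorem pair_inj {a b a' b' : 𝓜.carrier} (h : 𝓜.pair a b = 𝓜.pair a' b') : a = a' ∧ b = b' := by
  obtain ⟨hs, rfl⟩ := mul_self_add_inj (le_self_add : a ≤ a + b) (le_self_add : a' ≤ a' + b') h
  exact ⟨rfl, add_left_cancel hs⟩

theorem le_mul_self (a : 𝓜.carrier) : a ≤ a * a := by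
  rcases eq_or_ne a 0 with rfl | h
  · simp
  · exact le_mul_of_one_le_left (zero_le a) (Order.one_le_iff_pos.2 (pos_iff_ne_zero.2 h))

theorem left_le_pair (a b : 𝓜.carrier) : a ≤ 𝓜.pair a b := le_add_self

theorem right_le_pair (a b : 𝓜.carrier) : b ≤ 𝓜.pair a b :=
  (le_add_self.trans (le_mul_self (a + b))).trans le_self_add

/-- It supplies `⟨k, k⟩` as a common bound for the codes of all pairs of numbers below `k`. -/
theorem pair_lt_pair {a b a' b' : 𝓜.carrier} (ha : a < a') (hb : b < b') :
    𝓜.pair a b < 𝓜.pair a' b' :=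
  add_lt_add_of_le_of_lt (mul_le_mul' (add_le_add ha.le hb.le) (add_le_add ha.le hb.le)) ha

/-! ### Powers of two, binary codes of bounded sets, and the pigeonhole principle -/

variable (𝓜) in
/-- The power `2 ^ n` in `𝓜`. -/
def twoPow (n : 𝓜.carrier) : 𝓜.carrier := 𝓜.exp 2 n

theorem twoPow_zero : 𝓜.twoPow 0 = 1 := h𝓜.out.exp_zero 2
theorem twoPow_succ (n : 𝓜.carrier) : 𝓜.twoPow (n + 1) = 𝓜.twoPow n * 2 := h𝓜.out.exp_succ 2 n

theorem IsTerm.twoPow {n : ℕ} {t : (Fin n → 𝓜.carrier) → 𝓜.carrier}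
    (ht : IsTerm t) : IsTerm (fun v => 𝓜.twoPow (t v)) := (IsTerm.const 2).exp ht

theorem twoPow_add (a b : 𝓜.carrier) : 𝓜.twoPow (a + b) = 𝓜.twoPow a * 𝓜.twoPow b := by
  refine ind (P := fun b => 𝓜.twoPow (a + b) = 𝓜.twoPow a * 𝓜.twoPow b) ?_ ?_ (fun x hx => ?_) b
  · apply_rules [IsDelta.eq, IsTerm.mul, IsTerm.twoPow, IsTerm.add, IsTerm.const, IsTerm.var]
  · simp [twoPow_zero]
  · rw [← _root_.add_assoc, twoPow_succ, twoPow_succ, hx, _root_.mul_assoc]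

theorem twoPow_pos (a : 𝓜.carrier) : 0 < 𝓜.twoPow a := by
  refine ind (P := fun a => 0 < 𝓜.twoPow a) ?_ (by simp [twoPow_zero]) (fun x hx => ?_) a
  · apply_rules [IsDelta.lt, IsTerm.twoPow, IsTerm.const, IsTerm.var]
  · rw [twoPow_succ]; exact mul_pos hx two_pos

/-- The `i`-th binary digit of `w` is `1`. -/
def Bit (i w : 𝓜.carrier) : Prop :=
  ∃ q, q < w + 1 ∧ ∃ r, r < 𝓜.twoPow i ∧ w = (2 * q + 1) * 𝓜.twoPow i + r

theorem IsDelta.bit {n : ℕ} {s t : (Fin n → 𝓜.carrier) → 𝓜.carrier} (hs : IsTerm s)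
    (ht : IsTerm t) : IsDelta (fun v => Bit (s v) (t v)) := by
  have hs' := hs.lift
  have hs'' := hs.lift.lift
  have ht' := ht.lift.lift
  apply_rules [IsDelta.lt, IsDelta.eq, IsDelta.bex, IsDelta.and, IsTerm.mul, IsTerm.add,
    IsTerm.twoPow, IsTerm.const, IsTerm.var]

/-- The `i`-th binary digit of `w` is `0`. -/
def NotBit (i w : 𝓜.carrier) : Prop :=
  ∃ q, q < w + 1 ∧ ∃ r, r < 𝓜.twoPow i ∧ w = 2 * q * 𝓜.twoPow i + r

theorem IsDelta.notBit {n : ℕ} {s t : (Fin n → 𝓜.carrier) → 𝓜.carrier} (hs : IsTerm s)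
    (ht : IsTerm t) : IsDelta (fun v => NotBit (s v) (t v)) := by
  have hs' := hs.lift
  have hs'' := hs.lift.lift
  have ht' := ht.lift.lift
  apply_rules [IsDelta.lt, IsDelta.eq, IsDelta.bex, IsDelta.and, IsTerm.mul, IsTerm.add,
    IsTerm.twoPow, IsTerm.const, IsTerm.var]

attribute [irreducible] Bit NotBit

theorem bit_iff {i w : 𝓜.carrier} : Bit i w ↔
    ∃ q, q < w + 1 ∧ ∃ r, r < 𝓜.twoPow i ∧ w = (2 * q + 1) * 𝓜.twoPow i + r := by
  unfold Bit; rfl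

theorem notBit_iff {i w : 𝓜.carrier} : NotBit i w ↔
    ∃ q, q < w + 1 ∧ ∃ r, r < 𝓜.twoPow i ∧ w = 2 * q * 𝓜.twoPow i + r := by
  unfold NotBit; rfl

theorem quotient_unique {d q q' r r' : 𝓜.carrier} (hr : r < d) (hr' : r' < d)
    (h : q * d + r = q' * d + r') : q = q' := by
  have key : ∀ {q q' r r' : 𝓜.carrier}, r < d → q < q' → q * d + r < q' * d + r' := by
    intro q q' r r' hr hq
    calc q * d + r < q * d + d := add_lt_add_right hr _
      _ = (q + 1) * d := by ring
      _ ≤ q' * d := mul_le_mul_left (Order.add_one_le_of_lt hq) d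
      _ ≤ q' * d + r' := le_self_add
  rcases _root_.lt_trichotomy q q' with hq | rfl | hq
  · exact absurd h (key hr hq).ne
  · rfl
  · exact absurd h (key hr' hq).ne'

theorem two_mul_add_one_ne (a b : 𝓜.carrier) : 2 * a + 1 ≠ 2 * b := by
  intro h
  rcases le_or_gt b a with hab | hab
  · have : 2 * b ≤ 2 * a := mul_le_mul_right hab 2
    exact absurd h (lt_of_le_of_lt this (lt_succ_self _)).ne'
  · have : 2 * (a + 1) ≤ 2 * b := mul_le_mul_right (Order.add_one_le_of_lt hab) 2
    rw [← h, show 2 * (a + 1) = 2 * a + 1 + 1 by ring] at this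
    exact absurd this (lt_succ_self _).not_ge

/-- Otherwise the quotient of `w` by `2 ^ i` would be both even and odd. -/
theorem NotBit.not_bit {i w : 𝓜.carrier} (h : NotBit i w) : ¬ Bit i w := by
  rw [bit_iff]
  rintro ⟨q, -, r, hr, hw⟩
  obtain ⟨q', -, r', hr', hw'⟩ := notBit_iff.1 h
  exact two_mul_add_one_ne q q' (quotient_unique hr hr' (hw.symm.trans hw'))

theorem le_two_mul_mul_add {i q r : 𝓜.carrier} : q ≤ 2 * q * 𝓜.twoPow i + r :=
  calc q ≤ 2 * q := le_mul_of_one_le_left (zero_le q) one_le_two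
    _ ≤ 2 * q * 𝓜.twoPow i :=
      le_mul_of_one_le_right (zero_le _) (Order.one_le_iff_pos.2 (twoPow_pos i))
    _ ≤ _ := le_self_add

theorem bit_of_eq {i w q r : 𝓜.carrier} (hr : r < 𝓜.twoPow i)
    (h : w = (2 * q + 1) * 𝓜.twoPow i + r) : Bit i w := by
  refine bit_iff.2 ⟨q, lt_add_one_iff'.2 ?_, r, hr, h⟩
  rw [h, show (2 * q + 1) * 𝓜.twoPow i + r = 2 * q * 𝓜.twoPow i + (𝓜.twoPow i + r) by ring]
  exact le_two_mul_mul_add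

theorem notBit_of_eq {i w q r : 𝓜.carrier} (hr : r < 𝓜.twoPow i)
    (h : w = 2 * q * 𝓜.twoPow i + r) : NotBit i w :=
  notBit_iff.2 ⟨q, lt_add_one_iff'.2 (h ▸ le_two_mul_mul_add), r, hr, h⟩

theorem notBit_of_lt {i w : 𝓜.carrier} (h : w < 𝓜.twoPow i) : NotBit i w :=
  notBit_of_eq (q := 0) h (by ring)

/-- Adding `2 ^ n` with `i < n` therefore changes the quotient by `2 ^ i` by an even number, and
leaves the `i`-th digit unchanged. -/
theorem exists_twoPow_eq {i n : 𝓜.carrier} (h : i < n) :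
    ∃ p, 𝓜.twoPow n = 2 * p * 𝓜.twoPow i := by
  obtain ⟨k, rfl⟩ := exists_add_of_le (Order.add_one_le_of_lt h)
  exact ⟨𝓜.twoPow k, by rw [twoPow_add, twoPow_succ]; ring⟩

theorem Bit.add_twoPow {i n w : 𝓜.carrier} (h : Bit i w) (hi : i < n) :
    Bit i (w + 𝓜.twoPow n) := by
  obtain ⟨q, -, r, hr, hw⟩ := bit_iff.1 h
  obtain ⟨p, hp⟩ := exists_twoPow_eq hi
  exact bit_of_eq (q := q + p) hr (by rw [hw, hp]; ring)

theorem NotBit.add_twoPow {i n w : 𝓜.carrier} (h : NotBit i w) (hi : i < n) :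
    NotBit i (w + 𝓜.twoPow n) := by
  obtain ⟨q, -, r, hr, hw⟩ := notBit_iff.1 h
  obtain ⟨p, hp⟩ := exists_twoPow_eq hi
  exact notBit_of_eq (q := q + p) hr (by rw [hw, hp]; ring)

/-- Induction on `n`, with `2 ^ n` added to the code when `n ∈ X`. The bound on `w` keeps the
induction formula bounded. Both digit values are carried as positive statements, since each has a
witness that survives the addition. -/
theorem exists_code_below {X : Set 𝓜.carrier} (hX : X ∈ 𝓜.sets) (n : 𝓜.carrier) :
    ∃ w, w < 𝓜.twoPow n ∧ ∀ i, i < n → (i ∈ X ∧ Bit i w) ∨ (i ∉ X ∧ NotBit i w) := by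
  refine ind (P := fun n => ∃ w, w < 𝓜.twoPow n ∧
    ∀ i, i < n → (i ∈ X ∧ Bit i w) ∨ (i ∉ X ∧ NotBit i w)) ?_ ?_ (fun n hn => ?_) n
  · apply_rules (maxDepth := 200) [IsDelta.bex, IsDelta.ball, IsDelta.or, IsDelta.and, IsDelta.not, IsDelta.mem,
      IsDelta.bit, IsDelta.notBit, IsTerm.twoPow, IsTerm.var]
  · exact ⟨0, twoPow_pos _, fun i hi => absurd hi (not_lt_zero i)⟩
  · obtain ⟨w, hw, h⟩ := hn
    have hw2 : w + 𝓜.twoPow n < 𝓜.twoPow (n + 1) := by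
      rw [twoPow_succ, mul_two]; exact add_lt_add_left hw _
    by_cases hX : n ∈ X
    · refine ⟨w + 𝓜.twoPow n, hw2, fun i hi => ?_⟩
      rcases lt_succ.1 hi with hi | rfl
      · exact (h i hi).imp (fun h => ⟨h.1, h.2.add_twoPow hi⟩) (fun h => ⟨h.1, h.2.add_twoPow hi⟩)
      · exact .inl ⟨hX, bit_of_eq (q := 0) hw (by ring)⟩
    · refine ⟨w, lt_of_le_of_lt le_self_add hw2, fun i hi => ?_⟩
      rcases lt_succ.1 hi with hi | rfl
      · exact h i hi
      · exact .inr ⟨hX, notBit_of_lt hw⟩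

/-- Every bounded set of `𝓜` is the set of positions of the digits `1` of some number. -/
theorem exists_code {X : Set 𝓜.carrier} (hX : X ∈ 𝓜.sets) {n : 𝓜.carrier} (hn : ∀ i ∈ X, i < n) :
    ∃ w, w < 𝓜.twoPow n ∧ ∀ i, Bit i w ↔ i ∈ X := by
  obtain ⟨w, hw, h⟩ := exists_code_below hX n
  refine ⟨w, hw, fun i => ?_⟩
  rcases lt_or_ge i n with hi | hi
  · rcases h i hi with h | h
    · simp [h]
    · simp [h.1, h.2.not_bit]
  · have h1 : w < 𝓜.twoPow i := by
      obtain ⟨k, rfl⟩ := exists_add_of_le hi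
      rw [twoPow_add]
      exact hw.trans_le
        (le_mul_of_one_le_right (zero_le _) (Order.one_le_iff_pos.2 (twoPow_pos k)))
    exact iff_of_false (notBit_of_lt h1).not_bit fun h => absurd (hn i h) hi.not_gt

theorem IsDelta.le {n : ℕ} {s t : (Fin n → 𝓜.carrier) → 𝓜.carrier}
    (hs : IsTerm s) (ht : IsTerm t) : IsDelta (fun v => s v ≤ t v) :=
  ((IsDelta.lt hs ht).or (.eq hs ht)).congr fun _ => le_iff_lt_or_eq.symm

theorem comprehend {P : 𝓜.carrier → Prop}
    (hP : IsDelta (fun v : Fin 1 → 𝓜.carrier => P (v 0))) : {x | P x} ∈ 𝓜.sets :=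
  h𝓜.out.comprehension hP

/-- A form of the pigeonhole principle: no coded relation is total and injective from `[0, n]` to
`[0, n)`. -/
theorem pigeonhole_code (k n : 𝓜.carrier) : n ≤ k → ∀ w, w < 𝓜.twoPow (𝓜.pair k k) →
    ¬ ((∀ i, i < n + 1 → ∃ y, y < n ∧ Bit (𝓜.pair i y) w) ∧
      ∀ i, i < n + 1 → ∀ j, j < n + 1 → ∀ y, y < n →
        Bit (𝓜.pair i y) w → Bit (𝓜.pair j y) w → i = j) := by
  refine ind (P := fun n => n ≤ k → ∀ w, w < 𝓜.twoPow (𝓜.pair k k) →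
    ¬ ((∀ i, i < n + 1 → ∃ y, y < n ∧ Bit (𝓜.pair i y) w) ∧
      ∀ i, i < n + 1 → ∀ j, j < n + 1 → ∀ y, y < n →
        Bit (𝓜.pair i y) w → Bit (𝓜.pair j y) w → i = j)) ?_ ?_ ?_ n
  · apply_rules (maxDepth := 200) [IsDelta.bex, IsDelta.ball, IsDelta.and, IsDelta.not, IsDelta.imp, IsDelta.eq,
      IsDelta.le, IsDelta.bit, IsTerm.twoPow, IsTerm.pair, IsTerm.add, IsTerm.const, IsTerm.var]
  · rintro - w - ⟨h, -⟩
    obtain ⟨y, hy, -⟩ := h 0 (lt_succ_self 0)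
    exact not_lt_zero _ hy
  · rintro n ih hnk w - ⟨htot, hinj⟩
    -- The relation is rerouted to avoid the value `n`: an argument related to `n` takes over the
    -- values below `n` of the last argument `n + 1`, which is dropped.
    have hX : {m | ∃ i, i < n + 1 ∧ ∃ y, y < n ∧ m = 𝓜.pair i y ∧ (Bit (𝓜.pair i y) w ∨
        Bit (𝓜.pair i n) w ∧ Bit (𝓜.pair (n + 1) y) w)} ∈ 𝓜.sets := by
      apply comprehend
      apply_rules (maxDepth := 200) [IsDelta.bex, IsDelta.ball, IsDelta.and, IsDelta.or, IsDelta.eq,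
        IsDelta.bit, IsTerm.pair, IsTerm.add, IsTerm.const, IsTerm.var]
    obtain ⟨w', hw', h'⟩ := exists_code hX (n := 𝓜.pair k k) (by
      rintro m ⟨i, hi, y, hy, rfl, -⟩
      have hn : n < k := (Order.add_one_le_iff.1 hnk)
      exact pair_lt_pair (lt_of_lt_of_le hi hnk) (hy.trans hn))
    have h'' : ∀ i, i < n + 1 → ∀ y, y < n → (Bit (𝓜.pair i y) w' ↔ (Bit (𝓜.pair i y) w ∨
        Bit (𝓜.pair i n) w ∧ Bit (𝓜.pair (n + 1) y) w)) := by
      intro i hi y hy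
      rw [h']
      constructor
      · rintro ⟨i', -, y', -, e, h⟩
        obtain ⟨rfl, rfl⟩ := pair_inj e
        exact h
      · exact fun h => ⟨i, hi, y, hy, rfl, h⟩
    have up : ∀ {i}, i < n + 1 → i < n + 1 + 1 := fun h => lt_succ.2 (.inl h)
    refine ih ((lt_succ_self n).le.trans hnk) w' hw' ⟨fun i hi => ?_, fun i hi j hj y hy h1 h2 => ?_⟩
    · obtain ⟨y, hy, hb⟩ := htot i (up hi)
      rcases lt_succ.1 hy with hy | rfl
      · exact ⟨y, hy, (h'' i hi y hy).2 (.inl hb)⟩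
      · obtain ⟨z, hz, hb'⟩ := htot (y + 1) (lt_succ_self _)
        -- If the last argument also has the old top value, it shares it with `i`, against
        -- injectivity.
        rcases lt_succ.1 hz with hz | rfl
        · exact ⟨z, hz, (h'' i hi z hz).2 (.inr ⟨hb, hb'⟩)⟩
        · exact absurd (hinj i (up hi) _ (lt_succ_self _) z (lt_succ_self _) hb hb') hi.ne
    · rw [h'' i hi y hy] at h1
      rw [h'' j hj y hy] at h2
      -- In the mixed cases an old argument would share the value `y` with `n + 1`; if both are
      -- rerouted, they share the value `n`.
      rcases h1 with h1 | h1 <;> rcases h2 with h2 | h2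
      · exact hinj i (up hi) j (up hj) y (lt_succ.2 (.inl hy)) h1 h2
      · exact absurd (hinj i (up hi) _ (lt_succ_self _) y (lt_succ.2 (.inl hy)) h1 h2.2) hi.ne
      · exact absurd (hinj j (up hj) _ (lt_succ_self _) y (lt_succ.2 (.inl hy)) h2 h1.2) hj.ne
      · exact hinj i (up hi) j (up hj) n (lt_succ_self n) h1.1 h2.1

end Arithmetic
end ArithStructure

/-! ### Finite sequences of iterates -/

namespace ArithStructure.InternalStructure
open Basic

variable {𝓜 : ArithStructure.{u}} (𝔸 : 𝓜.InternalStructure)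

/-- The set of codes of the graph of `s` on `[0, x]`. -/
def seqGraph (x : 𝓜.carrier) (s : 𝓜.carrier → 𝔸.A) : Set 𝓜.carrier :=
  {m | ∃ z, (𝓜.lt z x ∨ z = x) ∧ m = 𝓜.pair z (s z)}

/-- The values of `s` on `[0, x]` are the iterates of `f` at `c`, and form a finite sequence. -/
structure IsSeq (x : 𝓜.carrier) (s : 𝓜.carrier → 𝔸.A) : Prop where
  finite : 𝓜.IsFiniteSet (𝔸.seqGraph x s)
  zero : s 0 = 𝔸.c
  succ : ∀ z, z < x → s (z + 1) = 𝔸.f (s z)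

/-- The set of codes of the graph of `f`. -/
def funGraph : Set 𝓜.carrier := {m | ∃ a : 𝔸.A, m = 𝓜.pair a (𝔸.f a)}

variable {𝔸}

theorem isIterate_iff {x : 𝓜.carrier} {a : 𝔸.A} : 𝔸.IsIterate x a ↔ ∃ s, 𝔸.IsSeq x s ∧ s x = a :=
  ⟨fun ⟨s, h1, h2, h3, h4⟩ => ⟨s, ⟨h1, h2, h3⟩, h4⟩, fun ⟨s, ⟨h1, h2, h3⟩, h4⟩ => ⟨s, h1, h2, h3, h4⟩⟩

variable [h𝓜 : Fact 𝓜.IsModelRCAStar]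

theorem pair_mem_seqGraph {x z y : 𝓜.carrier} {s : 𝓜.carrier → 𝔸.A} :
    𝓜.pair z y ∈ 𝔸.seqGraph x s ↔ z ≤ x ∧ y = s z := by
  constructor
  · rintro ⟨z', hz, h⟩
    obtain ⟨rfl, rfl⟩ := pair_inj h
    exact ⟨hz, rfl⟩
  · rintro ⟨hz, rfl⟩
    exact ⟨z, hz, rfl⟩

theorem pair_mem_funGraph {a : 𝔸.A} {y : 𝓜.carrier} :
    𝓜.pair a y ∈ 𝔸.funGraph ↔ y = 𝔸.f a := by
  constructor
  · rintro ⟨b, h⟩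
    obtain ⟨hab, hy⟩ := pair_inj h
    rw [hy, Subtype.ext hab]
  · rintro rfl
    exact ⟨a, rfl⟩

namespace IsSeq

variable {x x' : 𝓜.carrier} {s s' : 𝓜.carrier → 𝔸.A}

theorem exists_bound (h : 𝔸.IsSeq x s) : ∃ N, ∀ z ≤ x, (s z : 𝓜.carrier) < N := by
  obtain ⟨N, hN⟩ := h.finite.2
  exact ⟨N, fun z hz => lt_of_le_of_lt (right_le_pair _ _) (hN _ (pair_mem_seqGraph.2 ⟨hz, rfl⟩))⟩

/-- The function `s` is not a term, so a statement about `s (t v)` is expressed through membership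
in the graph, which is a set of `𝓜`, with the value quantified below a bound for the sequence. -/
theorem isDelta (h : 𝔸.IsSeq x s) {n : ℕ} {t : (Fin n → 𝓜.carrier) → 𝓜.carrier} (ht : IsTerm t)
    {Q : (Fin n → 𝓜.carrier) → 𝓜.carrier → Prop}
    (hQ : IsDelta (fun w : Fin (n + 1) → 𝓜.carrier => Q (fun i => w i.succ) (w 0))) :
    IsDelta (fun v => t v ≤ x → Q v (s (t v))) := by
  obtain ⟨N, hN⟩ := h.exists_bound
  have : IsDelta (fun v => ∀ y, y < N → 𝓜.pair (t v) y ∈ 𝔸.seqGraph x s → Q v y) :=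
    .ball (.const N) (.imp (.mem h.finite.1 (.pair ht.lift (.var 0))) hQ)
  refine this.congr fun v => ?_
  constructor
  · exact fun H hv => H _ (hN _ hv) (pair_mem_seqGraph.2 ⟨hv, rfl⟩)
  · rintro H y - hy
    obtain ⟨hv, rfl⟩ := pair_mem_seqGraph.1 hy
    exact H hv

theorem agree (h : 𝔸.IsSeq x s) (h' : 𝔸.IsSeq x' s') (z : 𝓜.carrier) :
    z ≤ x → z ≤ x' → s' z = s z := by
  refine ind (P := fun z => z ≤ x → z ≤ x' → s' z = s z) ?_ ?_ (fun z ih hz hz' => ?_) z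
  · simp only [Subtype.ext_iff]
    refine h.isDelta (.var 0) (Q := fun v y => v 0 ≤ x' → (s' (v 0) : 𝓜.carrier) = y) ?_
    exact h'.isDelta (.var 1) (Q := fun v y => y = v 0) (.eq (.var 0) (.var 1))
  · intro _ _; rw [h.zero, h'.zero]
  · rw [h.succ z (Order.add_one_le_iff.1 hz), h'.succ z (Order.add_one_le_iff.1 hz'),
      ih (Order.add_one_le_iff.1 hz).le (Order.add_one_le_iff.1 hz').le]

/-- Induction on the smaller index, cancelling one `f` at a time until `c` would be in its range.
The redundant `y < x + 1` makes the quantifier bounded, while `y ≤ x` has the shape required by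
`isDelta`. -/
theorem ne_of_lt (h : 𝔸.IsSeq x s) (hf : Function.Injective 𝔸.f) (hc : ∀ a, 𝔸.f a ≠ 𝔸.c)
    (z : 𝓜.carrier) : z ≤ x → ∀ y, y < x + 1 → y ≤ x → z < y → s y ≠ s z := by
  refine ind (P := fun z => z ≤ x → ∀ y, y < x + 1 → y ≤ x → z < y → s y ≠ s z)
    ?_ ?_ (fun z ih hz => ?_) z
  · simp only [ne_eq, Subtype.ext_iff]
    refine h.isDelta (.var 0)
      (Q := fun v a => ∀ y, y < x + 1 → y ≤ x → v 0 < y → ¬ (s y : 𝓜.carrier) = a) ?_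
    refine .ball (.add (.const _) (.const _)) ?_
    exact h.isDelta (.var 0) (Q := fun v b => v 2 < v 0 → ¬ b = v 1)
      (.imp (.lt (.var 3) (.var 1)) (.not (.eq (.var 0) (.var 2))))
  all_goals
    intros
    rename_i y _ hy hzy
    -- As `y` exceeds another number, it is a successor, and `s y` is a value of `f`.
    obtain ⟨y, rfl⟩ := exists_add_one_of_ne_zero (pos_iff_ne_zero.1 (lt_of_le_of_lt (zero_le _) hzy))
    rw [h.succ y (Order.add_one_le_iff.1 hy)]
  · rw [h.zero]; exact hc _
  · rw [h.succ z (Order.add_one_le_iff.1 hz)]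
    have hy' := (Order.add_one_le_iff.1 hy).le
    exact fun e => ih (Order.add_one_le_iff.1 hz).le y (lt_add_one_iff'.2 hy') hy'
      (lt_of_add_lt_add_right hzy) (hf e)

theorem injOn (h : 𝔸.IsSeq x s) (h' : 𝔸.IsSeq x' s') (hf : Function.Injective 𝔸.f)
    (hc : ∀ a, 𝔸.f a ≠ 𝔸.c) {z z' : 𝓜.carrier} (hz : z ≤ x) (hz' : z' ≤ x')
    (e : s z = s' z') : z = z' := by
  have key : ∀ {x x' : 𝓜.carrier} {s s' : 𝓜.carrier → 𝔸.A} {z z' : 𝓜.carrier}, 𝔸.IsSeq x s →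
      𝔸.IsSeq x' s' → z ≤ x → z' ≤ x' → z < z' → s z ≠ s' z' := by
    intro x x' s s' z z' h h' hz hz' hlt e
    have hzx' := hlt.le.trans hz'
    exact h'.ne_of_lt hf hc z hzx' z' (lt_add_one_iff'.2 hz') hz' hlt
      (by rw [← e, h.agree h' z hz hzx'])
  rcases _root_.lt_trichotomy z z' with hlt | rfl | hlt
  · exact absurd e (key h h' hz hz' hlt)
  · rfl
  · exact absurd e.symm (key h' h hz' hz hlt)

theorem exists_code (h : 𝔸.IsSeq x s) {k : 𝓜.carrier} (hx : x < k)
    (hs : ∀ z ≤ x, (s z : 𝓜.carrier) < k) :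
    ∃ w, w < 𝓜.twoPow (𝓜.pair k k) ∧ ∀ i, Bit i w ↔ i ∈ 𝔸.seqGraph x s :=
  ArithStructure.exists_code h.finite.1 (by
    rintro i ⟨z, hz, rfl⟩
    exact pair_lt_pair (lt_of_le_of_lt hz hx) (hs z hz))

/-- A sequence of distinct elements below `N` has at most `N` elements. -/
theorem lt_of_bound (h : 𝔸.IsSeq x s) (hf : Function.Injective 𝔸.f) (hc : ∀ a, 𝔸.f a ≠ 𝔸.c)
    {N : 𝓜.carrier} (hs : ∀ z ≤ x, (s z : 𝓜.carrier) < N) : x < N := by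
  by_contra! hN
  have hN' : N ≤ x + 1 := hN.trans le_self_add
  -- Here `x + 1` bounds both the arguments, at most `x`, and the values, below `N ≤ x + 1`.
  -- Restricted to `[0, N]`, the sequence then contradicts the pigeonhole principle.
  obtain ⟨w, hw, hbit⟩ := h.exists_code (lt_succ_self x) fun z hz => (hs z hz).trans_le hN'
  have hle : ∀ {i}, i < N + 1 → i ≤ x := fun hi => (lt_add_one_iff'.1 hi).trans hN
  refine pigeonhole_code (x + 1) N hN' w hw ⟨fun i hi => ?_, fun i hi j hj y hy h1 h2 => ?_⟩
  · exact ⟨s i, hs i (hle hi), (hbit _).2 (pair_mem_seqGraph.2 ⟨hle hi, rfl⟩)⟩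
  · obtain ⟨hi, rfl⟩ := pair_mem_seqGraph.1 ((hbit _).1 h1)
    obtain ⟨hj, e⟩ := pair_mem_seqGraph.1 ((hbit _).1 h2)
    exact h.injOn h hf hc hi hj (Subtype.ext e)

theorem extend (h : 𝔸.IsSeq x s) : ∃ s' : 𝓜.carrier → 𝔸.A, 𝔸.IsSeq (x + 1) s' ∧
    (∀ z ≤ x, s' z = s z) ∧ s' (x + 1) = 𝔸.f (s x) := by
  classical
  obtain ⟨s', hs'⟩ : ∃ s' : 𝓜.carrier → 𝔸.A, s' = fun z => if z ≤ x then s z else 𝔸.f (s x) :=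
    ⟨_, rfl⟩
  have hold : ∀ z ≤ x, s' z = s z := fun z hz => by simp [hs', hz]
  have hnew : s' (x + 1) = 𝔸.f (s x) := by simp [hs']
  have hgraph : 𝔸.seqGraph (x + 1) s' = {m | m ∈ 𝔸.seqGraph x s ∨ m = 𝓜.pair (x + 1) (𝔸.f (s x))} := by
    ext m
    constructor
    · rintro ⟨z, hz | rfl, rfl⟩
      · have hz' := lt_add_one_iff'.1 hz
        exact .inl (by rw [hold z hz']; exact pair_mem_seqGraph.2 ⟨hz', rfl⟩)
      · exact .inr (by rw [hnew])
    · rintro (⟨z, hz, rfl⟩ | rfl)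
      · exact ⟨z, .inl (lt_add_one_iff'.2 hz), by rw [hold z hz]⟩
      · exact ⟨x + 1, .inr rfl, by rw [hnew]⟩
  refine ⟨s', ⟨⟨?_, ?_⟩, ?_, fun z hz => ?_⟩, hold, hnew⟩
  · rw [hgraph]
    exact comprehend (.or (.mem h.finite.1 (.var 0)) (.eq (.var 0) (.const _)))
  · obtain ⟨b, hb⟩ := h.finite.2
    refine ⟨b + (𝓜.pair (x + 1) (𝔸.f (s x)) + 1), ?_⟩
    rw [hgraph]
    rintro m (hm | rfl)
    · exact (show m < b from hb m hm).trans_le le_self_add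
    · exact (Order.lt_add_one_iff.2 le_rfl).trans_le
        (le_add_self : 𝓜.pair (x + 1) (𝔸.f (s x)) + 1 ≤ b + (𝓜.pair (x + 1) (𝔸.f (s x)) + 1))
  · rw [hold 0 (zero_le x), h.zero]
  · rw [hold z (lt_add_one_iff'.1 hz)]
    rcases (lt_add_one_iff'.1 hz).lt_or_eq with hz | rfl
    · rw [hold _ (Order.add_one_le_of_lt hz), h.succ z hz]
    · exact hnew

end IsSeq

theorem isSeq_zero : 𝔸.IsSeq 0 (fun _ => 𝔸.c) := by
  refine ⟨⟨?_, 𝓜.pair 0 𝔸.c + 1, ?_⟩, rfl, fun z hz => (not_lt_zero z hz).elim⟩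
  · have : 𝔸.seqGraph 0 (fun _ => 𝔸.c) = {m | m = 𝓜.pair 0 𝔸.c} := by
      ext m
      constructor
      · rintro ⟨z, hz | rfl, rfl⟩
        · exact (not_lt_zero z hz).elim
        · rfl
      · rintro rfl
        exact ⟨0, .inr rfl, rfl⟩
    rw [this]
    exact comprehend (.eq (.var 0) (.const _))
  · rintro m ⟨z, hz | rfl, rfl⟩
    · exact (not_lt_zero z hz).elim
    · exact lt_succ_self _

variable (𝔸) in
/-- The digits of `w` code a sequence of iterates of `f` at `c` on `[0, x]`, with values below
`N`. -/
def IsSeqCode (N x w : 𝓜.carrier) : Prop :=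
  Bit (𝓜.pair 0 𝔸.c) w ∧ (𝔸.c : 𝓜.carrier) < N ∧
  (∀ z, z < x + 1 → ∃ y, y < N ∧ y ∈ 𝔸.A ∧ Bit (𝓜.pair z y) w) ∧
  (∀ z, z < x + 1 → ∀ y, y < N → ∀ y', y' < N →
    Bit (𝓜.pair z y) w → Bit (𝓜.pair z y') w → y = y') ∧
  ∀ z, z < x → ∀ y, y < N → ∀ y', y' < N →
    Bit (𝓜.pair z y) w → Bit (𝓜.pair (z + 1) y') w → 𝓜.pair y y' ∈ 𝔸.funGraph

theorem isDelta_isSeqCode {n : ℕ} {N x w : (Fin n → 𝓜.carrier) → 𝓜.carrier} (hN : IsTerm N)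
    (hx : IsTerm x) (hw : IsTerm w) : IsDelta (fun v => 𝔸.IsSeqCode (N v) (x v) (w v)) := by
  have hA := 𝔸.A_mem
  have hG : 𝔸.funGraph ∈ 𝓜.sets := 𝔸.graph_mem
  have hN1 := hN.lift
  have hN2 := hN1.lift
  have hw2 := hw.lift.lift
  have hw3 := hw2.lift
  apply_rules (maxDepth := 200) [IsDelta.bit, IsDelta.and, IsDelta.ball, IsDelta.bex, IsDelta.imp,
    IsDelta.eq, IsDelta.lt, IsDelta.mem, IsTerm.pair, IsTerm.add, IsTerm.const, IsTerm.var]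

attribute [irreducible] IsSeqCode

theorem isSeqCode_of_isSeq {x N w : 𝓜.carrier} {s : 𝓜.carrier → 𝔸.A} (h : 𝔸.IsSeq x s)
    (hs : ∀ z ≤ x, (s z : 𝓜.carrier) < N) (hw : ∀ i, Bit i w ↔ i ∈ 𝔸.seqGraph x s) :
    𝔸.IsSeqCode N x w := by
  unfold IsSeqCode
  simp only [hw, pair_mem_seqGraph]
  refine ⟨⟨zero_le x, by rw [h.zero]⟩, h.zero ▸ hs 0 (zero_le x), fun z hz => ?_, ?_, ?_⟩
  · have hz := lt_add_one_iff'.1 hz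
    exact ⟨s z, hs z hz, (s z).2, hz, rfl⟩
  · rintro z - y - y' - ⟨-, rfl⟩ ⟨-, rfl⟩
    rfl
  · rintro z hz y - y' - ⟨-, rfl⟩ ⟨-, rfl⟩
    rw [pair_mem_funGraph, h.succ z hz]

/-- Digits of `w` at other positions are unconstrained; the sequence is read off only from pairs
`⟨z, y⟩` with `z ≤ x` and `y < N`, where the value is unique. -/
theorem IsSeqCode.exists_isSeq {x N w : 𝓜.carrier} (h : 𝔸.IsSeqCode N x w) :
    ∃ s, 𝔸.IsSeq x s ∧ ∀ z ≤ x, (s z : 𝓜.carrier) < N ∧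
      ∀ y < N, Bit (𝓜.pair z y) w ↔ y = s z := by
  classical
  unfold IsSeqCode at h
  obtain ⟨h0, hcN, htot, hfun, hstep⟩ := h
  choose g hgN hgA hgw using htot
  -- The value `c` beyond `x` is arbitrary.
  obtain ⟨s, hs⟩ : ∃ s : 𝓜.carrier → 𝔸.A,
      s = fun z => if hz : z < x + 1 then ⟨g z hz, hgA z hz⟩ else 𝔸.c := ⟨_, rfl⟩
  have hsN : ∀ z ≤ x, (s z : 𝓜.carrier) < N := fun z hz => by
    rw [hs]; simp only [lt_add_one_iff'.2 hz, dite_true]; exact hgN _ _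
  have hsw : ∀ z ≤ x, Bit (𝓜.pair z (s z)) w := fun z hz => by
    rw [hs]; simp only [lt_add_one_iff'.2 hz, dite_true]; exact hgw _ _
  have hval : ∀ z ≤ x, ∀ y < N, Bit (𝓜.pair z y) w ↔ y = s z := fun z hz y hy =>
    ⟨fun hb => hfun z (lt_add_one_iff'.2 hz) y hy _ (hsN z hz) hb (hsw z hz),
      fun e => e ▸ hsw z hz⟩
  refine ⟨s, ⟨⟨?_, 𝓜.pair (x + 1) N, ?_⟩, ?_, fun z hz => ?_⟩, fun z hz => ⟨hsN z hz, hval z hz⟩⟩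
  · have : 𝔸.seqGraph x s =
        {m | ∃ z, z < x + 1 ∧ ∃ y, y < N ∧ m = 𝓜.pair z y ∧ Bit (𝓜.pair z y) w} := by
      ext m
      constructor
      · rintro ⟨z, hz, rfl⟩
        exact ⟨z, lt_add_one_iff'.2 hz, _, hsN z hz, rfl, hsw z hz⟩
      · rintro ⟨z, hz, y, hy, rfl, hb⟩
        have hz := lt_add_one_iff'.1 hz
        exact pair_mem_seqGraph.2 ⟨hz, (hval z hz y hy).1 hb⟩
    rw [this]
    apply comprehend
    apply_rules (maxDepth := 200) [IsDelta.bit, IsDelta.and, IsDelta.bex, IsDelta.eq,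
      IsTerm.pair, IsTerm.const, IsTerm.var]
  · rintro m ⟨z, hz, rfl⟩
    exact pair_lt_pair (lt_add_one_iff'.2 hz) (hsN z hz)
  · exact Subtype.ext ((hval 0 (zero_le x) _ hcN).1 h0).symm
  · have hz1 := Order.add_one_le_of_lt hz
    have := hstep z hz _ (hsN z hz.le) _ (hsN _ hz1) (hsw z hz.le) (hsw _ hz1)
    exact Subtype.ext (pair_mem_funGraph.1 this)

end ArithStructure.InternalStructure

/-! ### Reach relations, bounded sections and iterates -/

namespace ArithStructure.InternalStructure
open Basic

variable {𝓜 : ArithStructure.{u}} (𝔸 : 𝓜.InternalStructure)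

/-- The set of codes of a binary relation. -/
def relSet (r : 𝔸.A → 𝔸.A → Prop) : Set 𝓜.carrier :=
  {m | ∃ a b : 𝔸.A, r a b ∧ m = 𝓜.pair a b}

theorem isInternalRel_two {R : (Fin 2 → 𝔸.A) → Prop} :
    𝔸.IsInternalRel R ↔ 𝔸.relSet (fun a b => R ![a, b]) ∈ 𝓜.sets := by
  refine iff_of_eq (congrArg (· ∈ 𝓜.sets) (Set.ext fun m => ⟨?_, ?_⟩))
  · rintro ⟨a, ha, rfl⟩
    refine ⟨a 0, a 1, ?_, rfl⟩
    have : ![a 0, a 1] = a := funext fun i => by fin_cases i <;> rfl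
    exact this ▸ ha
  · rintro ⟨a, b, h, rfl⟩
    exact ⟨![a, b], h, rfl⟩

theorem isInternalRel_one {R : (Fin 1 → 𝔸.A) → Prop} :
    𝔸.IsInternalRel R ↔ {m : 𝓜.carrier | ∃ a : 𝔸.A, R ![a] ∧ m = a} ∈ 𝓜.sets := by
  refine iff_of_eq (congrArg (· ∈ 𝓜.sets) (Set.ext fun m => ⟨?_, ?_⟩))
  · rintro ⟨a, ha, rfl⟩
    refine ⟨a 0, ?_, rfl⟩
    rwa [show ![a 0] = a from funext fun i => by fin_cases i; rfl]
  · rintro ⟨a, h, rfl⟩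
    exact ⟨![a], h, rfl⟩

/-- `r b a` behaves as "`b` is reached from `c` no later than `a`". -/
structure IsReach (r : 𝔸.A → 𝔸.A → Prop) : Prop where
  refl : ∀ a, r a a
  of_succ : ∀ a b, r (𝔸.f b) a → r b a
  not_succ : ∀ a, ¬ r (𝔸.f a) a

variable {𝔸} [h𝓜 : Fact 𝓜.IsModelRCAStar]

theorem pair_mem_relSet {r : 𝔸.A → 𝔸.A → Prop} {a b : 𝔸.A} :
    𝓜.pair a b ∈ 𝔸.relSet r ↔ r a b := by
  constructor
  · rintro ⟨a', b', h, e⟩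
    obtain ⟨ha, hb⟩ := pair_inj e
    rwa [Subtype.ext ha, Subtype.ext hb]
  · exact fun h => ⟨a, b, h, rfl⟩

/-- This is the strict order for which a maximal element of a section is a bound for it. -/
theorem relSet_lt_mem : 𝔸.relSet (fun a b => (a : 𝓜.carrier) < b) ∈ 𝓜.sets := by
  have hA := 𝔸.A_mem
  have : {m | ∃ a, a < m + 1 ∧ ∃ b, b < m + 1 ∧ a ∈ 𝔸.A ∧ b ∈ 𝔸.A ∧ a < b ∧ m = 𝓜.pair a b}
      ∈ 𝓜.sets := by
    apply comprehend
    apply_rules (maxDepth := 200) [IsDelta.and, IsDelta.bex, IsDelta.eq, IsDelta.lt, IsDelta.mem,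
      IsTerm.pair, IsTerm.add, IsTerm.const, IsTerm.var]
  convert this using 1
  ext m
  constructor
  · rintro ⟨a, b, hab, rfl⟩
    exact ⟨a, lt_add_one_iff'.2 (left_le_pair _ _), b, lt_add_one_iff'.2 (right_le_pair _ _),
      a.2, b.2, hab, rfl⟩
  · rintro ⟨a, -, b, -, ha, hb, hab, rfl⟩
    exact ⟨⟨a, ha⟩, ⟨b, hb⟩, hab, rfl⟩

/-- A bounded section of an internal relation has an element that is maximal for a given internal
strict order. -/
theorem exists_maximal {r L : 𝔸.A → 𝔸.A → Prop} (hr : 𝔸.relSet r ∈ 𝓜.sets)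
    (hL : 𝔸.relSet L ∈ 𝓜.sets) (hirr : ∀ a, ¬ L a a) (htrans : ∀ a b d, L a b → L b d → L a d)
    {a : 𝔸.A} (ha : r a a) {N : 𝓜.carrier} (hN : ∀ b : 𝔸.A, r b a → (b : 𝓜.carrier) < N) :
    ∃ b, r b a ∧ ∀ d, r d a → ¬ L b d := by
  have key : ∀ n : 𝓜.carrier, ∃ m, m < N ∧ m ∈ 𝔸.A ∧ 𝓜.pair m a ∈ 𝔸.relSet r ∧
      ∀ d, d < n → d ∈ 𝔸.A → 𝓜.pair d a ∈ 𝔸.relSet r → ¬ 𝓜.pair m d ∈ 𝔸.relSet L := by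
    intro n
    -- The element `m` of the section has nothing `L`-above it among the members less than `n`. It
    -- starts as `a`, and is replaced by `n` when `n` is a member `L`-above it; transitivity
    -- preserves maximality.
    refine ind (P := fun n => ∃ m, m < N ∧ m ∈ 𝔸.A ∧ 𝓜.pair m a ∈ 𝔸.relSet r ∧
      ∀ d, d < n → d ∈ 𝔸.A → 𝓜.pair d a ∈ 𝔸.relSet r → ¬ 𝓜.pair m d ∈ 𝔸.relSet L) ?_ ?_ ?_ n
    · have hA := 𝔸.A_mem
      apply_rules (maxDepth := 200) [IsDelta.and, IsDelta.bex, IsDelta.ball, IsDelta.not,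
        IsDelta.imp, IsDelta.lt, IsDelta.mem, IsTerm.pair, IsTerm.const, IsTerm.var]
    · exact ⟨a, hN a ha, a.2, pair_mem_relSet.2 ha, fun d hd => (not_lt_zero d hd).elim⟩
    · rintro n ⟨m, hmN, hmA, hmr, hm⟩
      by_cases hn : ∃ b : 𝔸.A, (b : 𝓜.carrier) = n ∧ r b a ∧ L ⟨m, hmA⟩ b
      · obtain ⟨b, rfl, hb, hmb⟩ := hn
        refine ⟨b, hN b hb, b.2, pair_mem_relSet.2 hb, fun d hd hdA hdr hbd => ?_⟩
        have hbd' : L b ⟨d, hdA⟩ := pair_mem_relSet.1 hbd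
        rcases lt_succ.1 hd with hd | rfl
        · exact hm d hd hdA hdr (pair_mem_relSet.2 (htrans _ _ _ hmb hbd') :
            𝓜.pair (⟨m, hmA⟩ : 𝔸.A) (⟨d, hdA⟩ : 𝔸.A) ∈ 𝔸.relSet L)
        · exact hirr _ hbd'
      · refine ⟨m, hmN, hmA, hmr, fun d hd hdA hdr hmd => ?_⟩
        rcases lt_succ.1 hd with hd | rfl
        · exact hm d hd hdA hdr hmd
        · exact hn ⟨⟨d, hdA⟩, rfl, pair_mem_relSet.1 hdr,
            (pair_mem_relSet (a := ⟨m, hmA⟩) (b := ⟨d, hdA⟩)).1 hmd⟩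
  obtain ⟨m, -, hmA, hmr, hm⟩ := key N
  exact ⟨⟨m, hmA⟩, pair_mem_relSet.1 hmr, fun d hd hmd =>
    hm d (hN d hd) d.2 (pair_mem_relSet.2 hd)
      ((pair_mem_relSet (a := ⟨m, hmA⟩)).2 hmd)⟩

/-- In a Peano system, all elements are iterates if the initial segments are bounded. -/
theorem exists_isIterate (hP : 𝔸.IsPeanoSystem) {r : 𝔸.A → 𝔸.A → Prop}
    (hr : 𝔸.relSet r ∈ 𝓜.sets) (hR : 𝔸.IsReach r) {a : 𝔸.A} {N : 𝓜.carrier}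
    (hN : ∀ b : 𝔸.A, r b a → (b : 𝓜.carrier) < N) : ∃ x, 𝔸.IsIterate x a := by
  obtain ⟨hf, hc, hind⟩ := hP
  -- The bounds on the length and on the code make this set definable by a bounded formula. The
  -- guard `r b a` restricts the claim to the section, where values are below `N`.
  have hX : {b | b ∈ 𝔸.A ∧ (𝓜.pair b a ∈ 𝔸.relSet r → b < N ∧ ∃ x, x < N ∧
      ∃ w, w < 𝓜.twoPow (𝓜.pair N N) ∧ 𝔸.IsSeqCode N x w ∧ Bit (𝓜.pair x b) w)} ∈ 𝓜.sets := by
    have hA := 𝔸.A_mem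
    apply comprehend
    apply_rules (maxDepth := 200) [IsDelta.and, IsDelta.bex, IsDelta.imp, isDelta_isSeqCode,
      IsDelta.bit, IsDelta.lt, IsDelta.mem, IsTerm.twoPow, IsTerm.pair, IsTerm.const, IsTerm.var]
  have hmem : ∀ {x : 𝓜.carrier} {s : 𝓜.carrier → 𝔸.A}, 𝔸.IsSeq x s →
      (∀ z ≤ x, (s z : 𝓜.carrier) < N) → ∃ x', x' < N ∧ ∃ w, w < 𝓜.twoPow (𝓜.pair N N) ∧
        𝔸.IsSeqCode N x' w ∧ Bit (𝓜.pair x' (s x)) w := by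
    intro x s h hs
    have hx := h.lt_of_bound hf hc hs
    obtain ⟨w, hw, hbit⟩ := h.exists_code hx hs
    exact ⟨x, hx, w, hw, isSeqCode_of_isSeq h hs hbit,
      (hbit _).2 (pair_mem_seqGraph.2 ⟨le_rfl, rfl⟩)⟩
  have hmax := hind _ hX (fun b hb => hb.1) ⟨𝔸.c.2, fun h => ?_⟩ (fun b hb => ⟨(𝔸.f b).2, fun h => ?_⟩) a
  · obtain ⟨-, h⟩ := hmax
    obtain ⟨haN, x, -, w, -, hcode, hbit⟩ := h (pair_mem_relSet.2 (hR.refl a))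
    obtain ⟨s, hs, hval⟩ := hcode.exists_isSeq
    exact ⟨x, isIterate_iff.2 ⟨s, hs, Subtype.ext (((hval x le_rfl).2 _ haN).1 hbit).symm⟩⟩
  · have hcN := hN _ (pair_mem_relSet.1 h)
    exact ⟨hcN, hmem isSeq_zero fun _ _ => hcN⟩
  -- If `f b` is in the section, so is `b` by `of_succ`; its sequence is extended by the value `f
  -- b`, which is again below `N`.
  · have hfb := pair_mem_relSet.1 h
    have hfbN := hN _ hfb
    obtain ⟨hbN, x, -, w, -, hcode, hbit⟩ := hb.2 (pair_mem_relSet.2 (hR.of_succ _ _ hfb))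
    obtain ⟨s, hs, hval⟩ := hcode.exists_isSeq
    have hsx : s x = b := Subtype.ext (((hval x le_rfl).2 _ hbN).1 hbit).symm
    obtain ⟨s', hs', hold, hnew⟩ := hs.extend
    rw [hsx] at hnew
    refine ⟨hfbN, ?_⟩
    rw [← hnew]
    refine hmem hs' fun z hz => ?_
    rcases hz.lt_or_eq with hz | rfl
    · have hz := lt_add_one_iff'.1 hz
      rw [hold z hz]
      exact (hval z hz).1
    · rwa [hnew]

/-- If all elements are iterates, then initial segments are bounded. -/
theorem IsReach.exists_bound (hit : ∀ a, ∃ x, 𝔸.IsIterate x a) {r : 𝔸.A → 𝔸.A → Prop}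
    (hr : 𝔸.relSet r ∈ 𝓜.sets) (hR : 𝔸.IsReach r) (a : 𝔸.A) :
    ∃ N, ∀ b : 𝔸.A, r b a → (b : 𝓜.carrier) < N := by
  obtain ⟨x, hx⟩ := hit a
  obtain ⟨s, hs, rfl⟩ := isIterate_iff.1 hx
  obtain ⟨N, hN⟩ := hs.exists_bound
  refine ⟨N, fun b hb => ?_⟩
  obtain ⟨y, hy⟩ := hit b
  obtain ⟨s', hs', rfl⟩ := isIterate_iff.1 hy
  have hyx : y ≤ x := by
    by_contra! hxy
    -- Upward induction beyond `x`: the first step `x + 1` is excluded by `not_succ`, and exclusion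
    -- passes to each successor by the contrapositive of `of_succ`.
    have key : ∀ z, z ≤ y → x < z → ¬ r (s' z) (s x) := by
      intro z
      refine ind (P := fun z => z ≤ y → x < z → ¬ r (s' z) (s x)) ?_
        (fun _ h => (not_lt_zero _ h).elim) (fun z ih hz hxz h => ?_) z
      · simp only [← pair_mem_relSet]
        exact hs'.isDelta (.var 0) (Q := fun v b => x < v 0 → 𝓜.pair b (s x) ∉ 𝔸.relSet r)
          (.imp (.lt (.const _) (.var 1)) (.not (.mem hr (.pair (.var 0) (.const _)))))
      · have hz' := Order.add_one_le_iff.1 hz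
        rw [hs'.succ z hz'] at h
        rcases lt_succ.1 hxz with hxz | rfl
        · exact ih hz'.le hxz (hR.of_succ _ _ h)
        · rw [hs.agree hs' x le_rfl hz'.le] at h
          exact hR.not_succ _ h
    exact key y le_rfl hxy hb
  rw [hs.agree hs' y hyx le_rfl]
  exact hN y hyx

/-- The relation compares indices. Strict comparison is `Σ^0_1`, witnessed by a coded sequence
through both elements; since indices are linearly ordered and determine the elements, the negation
of `idx a ≤ idx b` is again such a comparison, so the relation is `Δ^0_1`. -/
theorem exists_isReach (hf : Function.Injective 𝔸.f) (hc : ∀ a, 𝔸.f a ≠ 𝔸.c)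
    (hit : ∀ a, ∃ x, 𝔸.IsIterate x a) :
    ∃ r : 𝔸.A → 𝔸.A → Prop, 𝔸.relSet r ∈ 𝓜.sets ∧ 𝔸.IsReach r := by
  choose idx hidx using hit
  choose s hs hsx using fun a => isIterate_iff.1 (hidx a)
  have idx_eq : ∀ {x s'} {z} {a : 𝔸.A}, 𝔸.IsSeq x s' → z ≤ x → s' z = a → z = idx a :=
    fun h' hz e => h'.injOn (hs _) hf hc hz le_rfl (by rw [e, hsx])
  have idx_inj : ∀ {a b}, idx a = idx b → a = b := fun {a b} e => by
    rw [← hsx a, ← hsx b, ← (hs a).agree (hs b) (idx a) le_rfl e.le, e]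
  have idx_f : ∀ b, idx (𝔸.f b) = idx b + 1 := by
    intro b
    rcases eq_or_ne (idx (𝔸.f b)) 0 with h0 | h0
    · exact absurd (by rw [← hsx (𝔸.f b), h0, (hs _).zero]) (hc b)
    · obtain ⟨y, hy⟩ := exists_add_one_of_ne_zero h0
      have hlt : y < idx (𝔸.f b) := hy ▸ lt_succ_self y
      have := (hs (𝔸.f b)).succ y hlt
      rw [← hy, hsx] at this
      rw [hy, idx_eq (hs (𝔸.f b)) hlt.le (hf this).symm]
  -- The number `t` bounds all the data of the witnessing sequence, so one unbounded quantifier over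
  -- `t` suffices.
  let D : 𝓜.carrier → 𝓜.carrier → 𝓜.carrier → Prop := fun t a b =>
    ∃ N, N < t ∧ ∃ x, x < t ∧ ∃ w, w < t ∧ ∃ z, z < x ∧ 𝔸.IsSeqCode N x w ∧ a < N ∧ b < N ∧
      Bit (𝓜.pair z a) w ∧ Bit (𝓜.pair x b) w
  have hD : ∀ a b : 𝔸.A, (∃ t, D t a b) ↔ idx a < idx b := by
    intro a b
    constructor
    · rintro ⟨t, N, -, x, -, w, -, z, hz, hcode, ha, hb, hza, hxb⟩
      obtain ⟨s', hs', hval⟩ := hcode.exists_isSeq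
      rw [← idx_eq hs' hz.le (Subtype.ext (((hval z hz.le).2 _ ha).1 hza).symm),
        ← idx_eq hs' le_rfl (Subtype.ext (((hval x le_rfl).2 _ hb).1 hxb).symm)]
      exact hz
    · intro hab
      obtain ⟨N, hN⟩ := (hs b).exists_bound
      have hxN : idx b < N + (idx b + 1) := (lt_succ_self _).trans_le le_add_self
      have hbd : ∀ z ≤ idx b, (s b z : 𝓜.carrier) < N + (idx b + 1) :=
        fun z hz => (hN z hz).trans_le le_self_add
      obtain ⟨w, hw, hbit⟩ := (hs b).exists_code hxN hbd
      have ha : s b (idx a) = a := by rw [(hs a).agree (hs b) _ le_rfl hab.le, hsx]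
      -- The summand `N` exceeds all values and `idx b + 1` exceeds the length, so the sum bounds
      -- both; adding `w + 1` gives a `t` above the code as well.
      have hNt : N + (idx b + 1) < N + (idx b + 1) + w + 1 := lt_add_one_iff'.2 le_self_add
      refine ⟨N + (idx b + 1) + w + 1, N + (idx b + 1), hNt, idx b, hxN.trans hNt, w,
        lt_add_one_iff'.2 le_add_self, idx a, hab, isSeqCode_of_isSeq (hs b) hbd hbit,
        by rw [← ha]; exact hbd _ hab.le, by have := hbd _ le_rfl; rwa [hsx b] at this, ?_, ?_⟩
      · exact (hbit _).2 (pair_mem_seqGraph.2 ⟨hab.le, by rw [ha]⟩)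
      · exact (hbit _).2 (pair_mem_seqGraph.2 ⟨le_rfl, by rw [hsx]⟩)
  refine ⟨fun a b => idx a ≤ idx b, ?_, fun a => le_rfl, fun a b h => ?_, fun a h => ?_⟩
  · have hA := 𝔸.A_mem
    have := h𝓜.out.comprehension_of_ex
      (P := fun t m => ∃ a, a < m + 1 ∧ ∃ b, b < m + 1 ∧ a ∈ 𝔸.A ∧ b ∈ 𝔸.A ∧ m = 𝓜.pair a b ∧
        (a = b ∨ D t a b))
      -- The complement consists of the numbers that code no pair from `A` and of the pairs whose
      -- second index is strictly smaller.
      (Q := fun t m => (¬ ∃ a, a < m + 1 ∧ ∃ b, b < m + 1 ∧ a ∈ 𝔸.A ∧ b ∈ 𝔸.A ∧ m = 𝓜.pair a b) ∨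
        ∃ a, a < m + 1 ∧ ∃ b, b < m + 1 ∧ a ∈ 𝔸.A ∧ b ∈ 𝔸.A ∧ m = 𝓜.pair a b ∧ D t b a)
      (by
        apply_rules (maxDepth := 200) [IsDelta.and, IsDelta.bex, IsDelta.or, isDelta_isSeqCode,
          IsDelta.bit, IsDelta.eq, IsDelta.lt, IsDelta.mem, IsTerm.pair, IsTerm.add, IsTerm.const,
          IsTerm.var])
      (by
        apply_rules (maxDepth := 200) [IsDelta.and, IsDelta.bex, IsDelta.or, IsDelta.not,
          isDelta_isSeqCode, IsDelta.bit, IsDelta.eq, IsDelta.lt, IsDelta.mem, IsTerm.pair,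
          IsTerm.add, IsTerm.const, IsTerm.var])
      ?_
    · convert this using 1
      ext m
      constructor
      · rintro ⟨a, b, hab, rfl⟩
        have hDab : ∃ t, (a : 𝓜.carrier) = b ∨ D t a b := by
          rcases hab.lt_or_eq with h | h
          · exact ((hD a b).2 h).imp fun _ => .inr
          · exact ⟨0, .inl (by rw [idx_inj h])⟩
        obtain ⟨t, ht⟩ := hDab
        exact ⟨t, a, lt_add_one_iff'.2 (left_le_pair _ _), b,
          lt_add_one_iff'.2 (right_le_pair _ _), a.2, b.2, rfl, ht⟩
      · rintro ⟨t, a, -, b, -, ha, hb, rfl, h⟩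
        refine ⟨⟨a, ha⟩, ⟨b, hb⟩, ?_, rfl⟩
        rcases h with rfl | h
        · exact le_rfl
        · exact ((hD ⟨a, ha⟩ ⟨b, hb⟩).1 ⟨t, h⟩).le
    · intro m
      constructor
      · rintro ⟨t, a, ham, b, hbm, ha, hb, rfl, h⟩ ⟨t', h' | ⟨a', -, b', -, -, -, e, h'⟩⟩
        · exact h' ⟨a, ham, b, hbm, ha, hb, rfl⟩
        · obtain ⟨rfl, rfl⟩ := pair_inj e
          have hba := (hD ⟨b, hb⟩ ⟨a, ha⟩).1 ⟨t', h'⟩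
          rcases h with rfl | h
          · exact absurd hba (_root_.lt_irrefl _)
          · exact absurd hba ((hD ⟨a, ha⟩ ⟨b, hb⟩).1 ⟨t, h⟩).not_gt
      · intro h
        by_cases hm : ∃ a b : 𝔸.A, m = 𝓜.pair a b
        · obtain ⟨a, b, rfl⟩ := hm
          have hDab : ∃ t, (a : 𝓜.carrier) = b ∨ D t a b := by
            rcases _root_.lt_trichotomy (idx a) (idx b) with hab | hab | hab
            · exact ((hD a b).2 hab).imp fun _ => .inr
            · exact ⟨0, .inl (by rw [idx_inj hab])⟩
            · obtain ⟨t, ht⟩ := (hD b a).2 hab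
              exact absurd ⟨t, .inr ⟨a, lt_add_one_iff'.2 (left_le_pair _ _), b,
                lt_add_one_iff'.2 (right_le_pair _ _), a.2, b.2, rfl, ht⟩⟩ h
          obtain ⟨t, ht⟩ := hDab
          exact ⟨t, a, lt_add_one_iff'.2 (left_le_pair _ _), b,
            lt_add_one_iff'.2 (right_le_pair _ _), a.2, b.2, rfl, ht⟩
        · exact absurd ⟨0, .inl fun ⟨a, _, b, _, ha, hb, e⟩ => hm ⟨⟨a, ha⟩, ⟨b, hb⟩, e⟩⟩ h
  · rw [idx_f] at h
    exact le_self_add.trans h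
  · rw [idx_f] at h
    exact absurd h (lt_succ_self _).not_ge

end ArithStructure.InternalStructure

/-! ### The sentence and its complexity -/

namespace SOFormula

/-- The first-order formula that expresses `IsReach` for a binary relation. -/
def reach {Γ : List ℕ} (R : ∀ {n}, PTerm n → PTerm n → SOFormula Γ n) : SOFormula Γ 0 :=
  .and (.all (R (.var 0) (.var 0)))
    (.and (.all (.all (.imp (R (.f (.var 0)) (.var 1)) (R (.var 0) (.var 1)))))
      (.all (.not (R (.f (.var 0)) (.var 0)))))

/-- The first-order formula that expresses that `L` is a strict order. -/
def strict {Γ : List ℕ} (L : ∀ {n}, PTerm n → PTerm n → SOFormula Γ n) : SOFormula Γ 0 :=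
  .and (.all (.not (L (.var 0) (.var 0))))
    (.all (.all (.all (.imp (L (.var 2) (.var 1)) (.imp (L (.var 1) (.var 0))
      (L (.var 2) (.var 0)))))))

/-- The first-order formula that expresses that each section of `R` has an `L`-maximal element. -/
def maximal {Γ : List ℕ} (R L : ∀ {n}, PTerm n → PTerm n → SOFormula Γ n) : SOFormula Γ 0 :=
  .all (.ex (.and (R (.var 0) (.var 1))
    (.all (.imp (R (.var 0) (.var 2)) (.not (L (.var 1) (.var 0)))))))

/-- The axioms of Peano systems, with induction for the unary relation `X`. -/
def peano {Γ : List ℕ} (X : ∀ {n}, PTerm n → SOFormula Γ n) : SOFormula Γ 0 :=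
  .and (.all (.all (.imp (.eq (.f (.var 1)) (.f (.var 0))) (.eq (.var 1) (.var 0)))))
    (.and (.all (.not (.eq (.f (.var 0)) .c)))
      (.imp (.and (X .c) (.all (.imp (X (.var 0)) (X (.f (.var 0)))))) (.all (X (.var 0)))))

/-- The `Σ^1_1` part: there is a relation that behaves as the order of a Peano system. -/
def existsReach : SOSentence :=
  .exRel 2 (reach fun s t => .rel (0 : Fin 1) ![s, t])

/-- The `Π^1_1` part: Peano's axioms, and the initial segments with respect to each relation that
behaves as the order of a Peano system have maximal elements for all strict orders. -/
def peanoFinite : SOSentence :=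
  .allRel 2 (.allRel 2 (.allRel 1
    (.and (peano fun t => .rel (0 : Fin 3) ![t])
      (.imp (reach fun s t => .rel (2 : Fin 3) ![s, t])
        (.imp (strict fun s t => .rel (1 : Fin 3) ![s, t])
          (maximal (fun s t => .rel (2 : Fin 3) ![s, t]) fun s t => .rel (1 : Fin 3) ![s, t]))))))

theorem isSigma11AndPi11 : (existsReach.and peanoFinite).IsSigma11AndPi11 :=
  ⟨_, _, .exRel (.firstOrder (by simp [reach, IsFirstOrder])),
    .allRel (.allRel (.allRel (.firstOrder
      (by simp [peano, reach, strict, maximal, IsFirstOrder])))), rfl⟩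

end SOFormula

/-! ### Meaning of the sentence and the equivalence -/

namespace ArithStructure.InternalStructure
open Basic

variable {𝓜 : ArithStructure.{u}} {𝔸 : 𝓜.InternalStructure} {Γ : List ℕ}
  {ρ : (i : Fin Γ.length) → (Fin (Γ.get i) → 𝔸.A) → Prop}

theorem sat_reach {R : ∀ {n}, PTerm n → PTerm n → SOFormula Γ n} {r : 𝔸.A → 𝔸.A → Prop}
    (hR : ∀ {n} (v : Fin n → 𝔸.A) (s t : PTerm n),
      𝔸.Sat (R s t) ρ v ↔ r (𝔸.termVal v s) (𝔸.termVal v t)) (v : Fin 0 → 𝔸.A) :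
    𝔸.Sat (SOFormula.reach R) ρ v ↔ 𝔸.IsReach r := by
  simp only [SOFormula.reach, Sat, hR]
  exact ⟨fun ⟨h1, h2, h3⟩ => ⟨h1, h2, h3⟩, fun ⟨h1, h2, h3⟩ => ⟨h1, h2, h3⟩⟩

theorem sat_strict {L : ∀ {n}, PTerm n → PTerm n → SOFormula Γ n} {l : 𝔸.A → 𝔸.A → Prop}
    (hL : ∀ {n} (v : Fin n → 𝔸.A) (s t : PTerm n),
      𝔸.Sat (L s t) ρ v ↔ l (𝔸.termVal v s) (𝔸.termVal v t)) (v : Fin 0 → 𝔸.A) :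
    𝔸.Sat (SOFormula.strict L) ρ v ↔
      (∀ a, ¬ l a a) ∧ ∀ a b d, l a b → l b d → l a d := by
  simp only [SOFormula.strict, Sat, hL]
  rfl

theorem sat_maximal {R L : ∀ {n}, PTerm n → PTerm n → SOFormula Γ n} {r l : 𝔸.A → 𝔸.A → Prop}
    (hR : ∀ {n} (v : Fin n → 𝔸.A) (s t : PTerm n),
      𝔸.Sat (R s t) ρ v ↔ r (𝔸.termVal v s) (𝔸.termVal v t))
    (hL : ∀ {n} (v : Fin n → 𝔸.A) (s t : PTerm n),
      𝔸.Sat (L s t) ρ v ↔ l (𝔸.termVal v s) (𝔸.termVal v t)) (v : Fin 0 → 𝔸.A) :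
    𝔸.Sat (SOFormula.maximal R L) ρ v ↔
      ∀ a, ∃ b, r b a ∧ ∀ d, r d a → ¬ l b d := by
  simp only [SOFormula.maximal, Sat, hR, hL]
  rfl

theorem sat_peano {X : ∀ {n}, PTerm n → SOFormula Γ n} {p : 𝔸.A → Prop}
    (hX : ∀ {n} (v : Fin n → 𝔸.A) (t : PTerm n), 𝔸.Sat (X t) ρ v ↔ p (𝔸.termVal v t))
    (v : Fin 0 → 𝔸.A) :
    𝔸.Sat (SOFormula.peano X) ρ v ↔ Function.Injective 𝔸.f ∧ (∀ a, 𝔸.f a ≠ 𝔸.c) ∧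
      ((p 𝔸.c ∧ ∀ a, p a → p (𝔸.f a)) → ∀ a, p a) := by
  simp only [SOFormula.peano, Sat, hX]
  rfl

theorem exists_binary (R : (Fin 2 → 𝔸.A) → Prop) :
    ∃ r : 𝔸.A → 𝔸.A → Prop, R = fun a => r (a 0) (a 1) :=
  ⟨fun a b => R ![a, b], funext fun a => congrArg R (funext fun i => by fin_cases i <;> rfl)⟩

theorem sat_existsReach (v : Fin 0 → 𝔸.A) (ρ) : 𝔸.Sat SOFormula.existsReach ρ v ↔
    ∃ r : 𝔸.A → 𝔸.A → Prop, 𝔸.relSet r ∈ 𝓜.sets ∧ 𝔸.IsReach r := by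
  constructor
  · rintro ⟨R, hR, h⟩
    obtain ⟨r, rfl⟩ := exists_binary R
    exact ⟨r, 𝔸.isInternalRel_two.1 hR, (sat_reach (r := r) (fun v s t => Iff.rfl) v).1 h⟩
  · rintro ⟨r, hr, h⟩
    exact ⟨fun a => r (a 0) (a 1), 𝔸.isInternalRel_two.2 hr,
      (sat_reach (r := r) (fun v s t => Iff.rfl) v).2 h⟩

theorem sat_peanoFinite (v : Fin 0 → 𝔸.A) (ρ) : 𝔸.Sat SOFormula.peanoFinite ρ v ↔
    ∀ r : 𝔸.A → 𝔸.A → Prop, 𝔸.relSet r ∈ 𝓜.sets → ∀ l : 𝔸.A → 𝔸.A → Prop,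
      𝔸.relSet l ∈ 𝓜.sets → ∀ p : 𝔸.A → Prop, {m : 𝓜.carrier | ∃ a : 𝔸.A, p a ∧ m = a} ∈ 𝓜.sets →
      (Function.Injective 𝔸.f ∧ (∀ a, 𝔸.f a ≠ 𝔸.c) ∧
        ((p 𝔸.c ∧ ∀ a, p a → p (𝔸.f a)) → ∀ a, p a)) ∧
      (𝔸.IsReach r → ((∀ a, ¬ l a a) ∧ ∀ a b d, l a b → l b d → l a d) →
        ∀ a, ∃ b, r b a ∧ ∀ d, r d a → ¬ l b d) := by
  constructor
  · intro h r hr l hl p hp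
    obtain ⟨h1, h2⟩ := h (fun a => r (a 0) (a 1)) (𝔸.isInternalRel_two.2 hr)
      (fun a => l (a 0) (a 1)) (𝔸.isInternalRel_two.2 hl) (fun a => p (a 0))
      (𝔸.isInternalRel_one.2 hp)
    refine ⟨(sat_peano (p := p) (fun v t => Iff.rfl) v).1 h1, fun hr hl => ?_⟩
    exact (sat_maximal (r := r) (l := l) (fun v s t => Iff.rfl) (fun v s t => Iff.rfl) v).1
      (h2 ((sat_reach (r := r) (fun v s t => Iff.rfl) v).2 hr)
        ((sat_strict (l := l) (fun v s t => Iff.rfl) v).2 hl))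
  · intro h R hR L hL X hX
    obtain ⟨r, rfl⟩ := exists_binary R
    obtain ⟨l, rfl⟩ := exists_binary L
    obtain ⟨p, rfl⟩ : ∃ p : 𝔸.A → Prop, X = fun a => p (a 0) :=
      ⟨fun a => X ![a], funext fun a => congrArg X (funext fun i => by fin_cases i; rfl)⟩
    obtain ⟨h1, h2⟩ := h r (𝔸.isInternalRel_two.1 hR) l (𝔸.isInternalRel_two.1 hL) p
      (𝔸.isInternalRel_one.1 hX)
    refine ⟨(sat_peano (p := p) (fun v t => Iff.rfl) v).2 h1, fun hr hl => ?_⟩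
    exact (sat_maximal (r := r) (l := l) (fun v s t => Iff.rfl) (fun v s t => Iff.rfl) v).2
      (h2 ((sat_reach (r := r) (fun v s t => Iff.rfl) v).1 hr)
        ((sat_strict (l := l) (fun v s t => Iff.rfl) v).1 hl))

theorem models_iff_isAlmostIsoNat [h𝓜 : Fact 𝓜.IsModelRCAStar] :
    𝔸.Models (SOFormula.existsReach.and SOFormula.peanoFinite) ↔ 𝔸.IsAlmostIsoNat := by
  -- The empty predicate serves as a dummy instance for the quantifiers over predicates.
  have hempty : ∀ X : Set 𝓜.carrier, (∀ m, m ∉ X) → X ∈ 𝓜.sets := by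
    intro X hX
    have := comprehend (𝓜 := 𝓜) (P := fun x => x < x) (.lt (.var 0) (.var 0))
    convert this using 1
    ext m
    simp [hX]
  refine (and_congr (sat_existsReach _ _) (sat_peanoFinite _ _)).trans ⟨?_, ?_⟩
  · rintro ⟨⟨r, hr, hR⟩, h⟩
    have hP : 𝔸.IsPeanoSystem := by
      refine ⟨(h r hr r hr _ (hempty _ fun m ⟨_, h, _⟩ => h)).1.1,
        (h r hr r hr _ (hempty _ fun m ⟨_, h, _⟩ => h)).1.2.1, fun X hX hXA hc hf => ?_⟩
      refine (h r hr r hr (fun a => (a : 𝓜.carrier) ∈ X) ?_).1.2.2 ⟨hc, hf⟩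
      convert hX using 1
      ext m
      exact ⟨fun ⟨a, ha, e⟩ => e ▸ ha, fun hm => ⟨⟨m, hXA hm⟩, hm, rfl⟩⟩
    refine ⟨hP, fun a => ?_⟩
    -- With the order of the numbers as `l`, the maximal element `b` is the greatest one of the
    -- section of `a`, so `b + 1` is a strict bound.
    obtain ⟨b, -, hb⟩ := (h r hr _ relSet_lt_mem _ (hempty _ fun m ⟨_, h, _⟩ => h)).2 hR
      ⟨fun _ => _root_.lt_irrefl _, fun _ _ _ => _root_.lt_trans⟩ a
    exact exists_isIterate hP hr hR (N := (b : 𝓜.carrier) + 1)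
      fun d hd => lt_add_one_iff'.2 (not_lt.1 (hb d hd))
  · rintro ⟨⟨hf, hc, hind⟩, hit⟩
    refine ⟨exists_isReach hf hc hit, fun r hr l hl p hp => ⟨⟨hf, hc, fun h a => ?_⟩, ?_⟩⟩
    · have key := hind _ hp (by rintro _ ⟨a, -, rfl⟩; exact a.2) ⟨_, h.1, rfl⟩
        (fun a ⟨b, hb, e⟩ => ⟨_, h.2 b hb, by rw [Subtype.ext e]⟩) a
      obtain ⟨b, hb, e⟩ := key
      rwa [Subtype.ext e]
    · intro hR hstrict a
      obtain ⟨N, hN⟩ := hR.exists_bound hit hr a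
      exact exists_maximal hr hl hstrict.1 hstrict.2 (hR.refl a) hN

end ArithStructure.InternalStructure

theorem lemma2p1 :
    ∃ ξ : SOSentence, ξ.IsSigma11AndPi11 ∧
      ∀ 𝓜 : ArithStructure.{u}, 𝓜.IsModelRCAStar →
        ∀ 𝔸 : 𝓜.InternalStructure, 𝔸.Models ξ ↔ 𝔸.IsAlmostIsoNat :=
  ⟨_, SOFormula.isSigma11AndPi11, fun 𝓜 h𝓜 _ =>
    haveI : Fact 𝓜.IsModelRCAStar := ⟨h𝓜⟩
    ArithStructure.InternalStructure.models_iff_isAlmostIsoNat⟩
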